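/- Fix a set $\Lambda$ of indices. Modal formulas are built from countably many propositional variables with $\bot$, $\to$ and $\Diamond_\lambda$ ($\lambda\in\Lambda$), and $\Box_\lambda=\neg\Diamond_\lambda\neg$; they are interpreted in Kripke frames $(W,(R_\lambda)_{\lambda\in\Lambda})$ as usual. A normal modal logic is a set of modal formulas that contains all propositional tautologies, the formulas $\Box_\lambda(p\to q)\to(\Box_\lambda p\to\Box_\lambda q)$ and $\Diamond_\lambda p\leftrightarrow\neg\Box_\lambda\neg p$, and is closed under modus ponens, uniform substitution and necessitation; a set $\Sigma$ of modal formulas axiomatises $L$ if $L$ is the smallest normal modal logic containing $\Sigma$. The canonical frame of $L$ consists of the maximal $L$-consistent sets, with $w R_\lambda w'$ iff $\Diamond_\lambda\varphi\in w$ for all $\varphi\in w'$. A formula $\varphi$ is canonical if it is valid in the canonical frame of the logic axiomatised by $\{\varphi\}$; a logic is canonical if all its formulas are valid in its canonical frame. A diagram is a pointed Kripke frame $\mathfrak D=(\{x_0,\dots,x_n\},(R^{\mathfrak D}_\lambda)_{\lambda\in\Lambda},x_0)$ with finitely many points and edges, in which every point is reachable from the root $x_0$ by a directed path. For a finite pointed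 frame $\mathfrak D$ with finitely many edges let $$\mathsf e^{\mathfrak D}(x_0)=\exists x_1\dots\exists x_n\bigwedge\{x_iR_\lambda x_j \mid x_iR^{\mathfrak D}_\lambda x_j\}.$$ A diagram $\mathfrak D$ is (globally) minimal if for no pointed frame $\mathfrak D'$ obtained from $\mathfrak D$ by deleting one edge the sentence $\forall x_0\,\mathsf e^{\mathfrak D'}(x_0)\to\forall x_0\,\mathsf e^{\mathfrak D}(x_0)$ is a theorem of first-order logic. An inner cycle of $\mathfrak D$ is an undirected closed path of positive length that never traverses an edge and then immediately goes back along the same edge, and that does not pass through $x_0$. **Theorem.** Let $\mathfrak D$ be a minimal diagram with an inner cycle, and let $L=\mathrm{Log}(\forall x_0\,\mathsf e^{\mathfrak D}(x_0))$ be the set of all modal formulas valid in all Kripke frames that satisfy $\forall x_0\,\mathsf e^{\mathfrak D}(x_0)$. Then $L$ is canonical, but every set of modal formulas that axiomatises $L$ contains infinitely many non-canonical formulas. -/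

import Mathlib

open FirstOrder

universe u

namespace ModalDiagram

/-! ### Modal formulas -/

/-- Modal formulas over a set `Λ` of indices; the propositional variables are `var 0, var 1, …`.
The primitives are `⊥`, `→` and the diamonds. -/
inductive ModalFormula (Λ : Type u) : Type u
  | var : ℕ → ModalFormula Λ
  | bot : ModalFormula Λ
  | imp : ModalFormula Λ → ModalFormula Λ → ModalFormula Λ
  | dia : Λ → ModalFormula Λ → ModalFormula Λ

namespace ModalFormula

variable {Λ : Type u}

/-- Negation. -/
def neg (φ : ModalFormula Λ) : ModalFormula Λ := imp φ bot

/-- The box `□ₐ φ`, an abbreviation for `¬ ◇ₐ ¬ φ`. -/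
def box (a : Λ) (φ : ModalFormula Λ) : ModalFormula Λ := neg (dia a (neg φ))

/-- Simultaneous substitution of formulas for propositional variables. -/
def subst (σ : ℕ → ModalFormula Λ) : ModalFormula Λ → ModalFormula Λ
  | var p => σ p
  | bot => bot
  | imp φ ψ => imp (subst σ φ) (subst σ ψ)
  | dia a φ => dia a (subst σ φ)

/-- Propositional tautologies: formulas that hold under every truth assignment respecting
`⊥` and `→` (variables and formulas beginning with a diamond are treated as atoms). -/
def IsTautology (φ : ModalFormula Λ) : Prop :=
  ∀ v : ModalFormula Λ → Prop, ¬ v bot → (∀ ψ χ, v (imp ψ χ) ↔ (v ψ → v χ)) → v φ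

end ModalFormula

open ModalFormula

/-! ### Kripke frames -/

/-- A Kripke frame with accessibility relations indexed by `Λ`. -/
structure KripkeFrame (Λ : Type u) where
  /-- the carrier -/
  W : Type u
  /-- the accessibility relations -/
  R : Λ → W → W → Prop

variable {Λ : Type u}

namespace KripkeFrame

/-- Truth of a modal formula at a point under a valuation. -/
def Sat (F : KripkeFrame Λ) (θ : ℕ → Set F.W) : F.W → ModalFormula Λ → Prop
  | x, var p => x ∈ θ p
  | _, bot => False
  | x, imp φ ψ => F.Sat θ x φ → F.Sat θ x ψ
  | x, dia a φ => ∃ y, F.R a x y ∧ F.Sat θ y φ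

/-- Validity of a modal formula in a Kripke frame. -/
def Valid (F : KripkeFrame Λ) (φ : ModalFormula Λ) : Prop :=
  ∀ (θ : ℕ → Set F.W) (x : F.W), F.Sat θ x φ

end KripkeFrame

/-- The set of modal formulas valid in all frames of a class. -/
def Log (C : Set (KripkeFrame Λ)) : Set (ModalFormula Λ) :=
  {φ | ∀ F ∈ C, F.Valid φ}

/-! ### Normal modal logics, axiomatisations, canonical formulas -/

/-- Normal modal logics. As the diamond is the primitive operator and the box an abbreviation,
the minimal normal logic is presented with the usual duality axiom `◇p ↔ ¬□¬p` besides the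
distribution axiom. -/
structure IsNormalLogic (L : Set (ModalFormula Λ)) : Prop where
  taut : ∀ φ, IsTautology φ → φ ∈ L
  axiomK : ∀ a : Λ,
    imp (box a (imp (var 0) (var 1))) (imp (box a (var 0)) (box a (var 1))) ∈ L
  dual_mp : ∀ a : Λ, imp (dia a (var 0)) (neg (box a (neg (var 0)))) ∈ L
  dual_mpr : ∀ a : Λ, imp (neg (box a (neg (var 0)))) (dia a (var 0)) ∈ L
  mp : ∀ φ ψ, φ ∈ L → imp φ ψ ∈ L → ψ ∈ L
  subst : ∀ (σ : ℕ → ModalFormula Λ) (φ), φ ∈ L → ModalFormula.subst σ φ ∈ L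
  nec : ∀ (a : Λ) (φ), φ ∈ L → box a φ ∈ L

/-- `Γ` axiomatises `L`: `L` is the smallest normal modal logic containing `Γ`. -/
def Axiomatises (Γ L : Set (ModalFormula Λ)) : Prop :=
  IsLeast {L' | IsNormalLogic L' ∧ Γ ⊆ L'} L

/-- The logic `K + Γ`. -/
def KPlus (Γ : Set (ModalFormula Λ)) : Set (ModalFormula Λ) :=
  ⋂₀ {L' | IsNormalLogic L' ∧ Γ ⊆ L'}

theorem axiomatises_KPlus (Γ : Set (ModalFormula Λ)) : Axiomatises Γ (KPlus Γ) := by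
  refine ⟨⟨⟨?_, ?_, ?_, ?_, ?_, ?_, ?_⟩, ?_⟩, ?_⟩
  · exact fun φ h L hL => hL.1.taut φ h
  · exact fun a L hL => hL.1.axiomK a
  · exact fun a L hL => hL.1.dual_mp a
  · exact fun a L hL => hL.1.dual_mpr a
  · exact fun φ ψ h1 h2 L hL => hL.1.mp φ ψ (h1 L hL) (h2 L hL)
  · exact fun σ φ h L hL => hL.1.subst σ φ (h L hL)
  · exact fun a φ h L hL => hL.1.nec a φ (h L hL)
  · exact fun φ h L hL => hL.2 h
  · exact fun L hL φ h => h L hL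

/-- `Δ` is `L`-consistent: for no `φ₁, …, φₖ ∈ Δ` is `φ₁ → (φ₂ → … → (φₖ → ⊥))` in `L`. -/
def Consistent (L Δ : Set (ModalFormula Λ)) : Prop :=
  ¬ ∃ l : List (ModalFormula Λ), (∀ φ ∈ l, φ ∈ Δ) ∧ l.foldr imp bot ∈ L

/-- The canonical frame of a logic: its points are the maximal consistent sets. -/
def canonicalFrame (L : Set (ModalFormula Λ)) : KripkeFrame Λ where
  W := {Δ : Set (ModalFormula Λ) // Maximal (Consistent L) Δ}
  R a Δ Θ := ∀ φ ∈ Θ.1, dia a φ ∈ Δ.1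

/-- A formula is canonical if it is valid in the canonical frame of the logic it axiomatises. -/
def IsCanonicalFormula (φ : ModalFormula Λ) : Prop :=
  (canonicalFrame (KPlus {φ})).Valid φ

/-- A logic is canonical if all its formulas are valid in its canonical frame. -/
def IsCanonicalLogic (L : Set (ModalFormula Λ)) : Prop :=
  ∀ φ ∈ L, (canonicalFrame L).Valid φ

/-! ### The first-order frame language -/

/-- The relation symbols: one binary symbol for every index. -/
inductive FrameRel (Λ : Type u) : ℕ → Type u
  | rel : Λ → FrameRel Λ 2

/-- The first-order language (with equality) of Kripke frames. -/
def frameLang (Λ : Type u) : FirstOrder.Language.{0, u} := ⟨fun _ => Empty, FrameRel Λ⟩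

/-- A Kripke frame as a first-order structure. -/
instance KripkeFrame.structure (F : KripkeFrame Λ) : (frameLang Λ).Structure F.W where
  funMap f := f.elim
  RelMap r := match r with
    | .rel a => fun x => F.R a (x 0) (x 1)

/-- The atomic formula `x Rₐ y`. -/
def atom {α : Type u} (a : Λ) (x y : α) : (frameLang Λ).Formula α :=
  FirstOrder.Language.Relations.formula₂ (L := frameLang Λ) (FrameRel.rel a)
    (FirstOrder.Language.Term.var x) (FirstOrder.Language.Term.var y)

/-! ### Diagrams -/

/-- A pointed Kripke frame with finitely many points and finitely many edges (the latter is
automatic if `Λ` is finite). -/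
structure FinPointedFrame (Λ : Type u) extends KripkeFrame Λ where
  /-- the distinguished point `x₀` -/
  root : W
  finite_points : Finite W
  finite_edges : {e : Λ × W × W | R e.1 e.2.1 e.2.2}.Finite

namespace FinPointedFrame

/-- The edges `(a, x, y)`, `x Rₐ y`. -/
def edges (D : FinPointedFrame Λ) : Set (Λ × D.W × D.W) := {e | D.R e.1 e.2.1 e.2.2}

instance (D : FinPointedFrame Λ) : Finite D.W := D.finite_points

instance (D : FinPointedFrame Λ) : Finite D.edges := D.finite_edges

/-- The conjunction of all atoms `x Rₐ y` that hold in `D`; the points of `D` are the variables. -/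
noncomputable def kFormula (D : FinPointedFrame Λ) : (frameLang Λ).Formula D.W :=
  FirstOrder.Language.Formula.iInf fun e : D.edges => atom e.1.1 e.1.2.1 e.1.2.2

open Classical in
/-- The formula `∃ x₁ … ∃ xₙ k(x₀, x₁, …, xₙ)`: all variables of `kFormula` except the root are
existentially quantified, and the root is the only free variable. -/
noncomputable def eFormula (D : FinPointedFrame Λ) : (frameLang Λ).Formula Unit :=
  FirstOrder.Language.Formula.iExs {x : D.W // x ≠ D.root}
    (D.kFormula.relabel fun x =>
      if h : x = D.root then Sum.inl () else Sum.inr (⟨x, h⟩ : {x : D.W // x ≠ D.root}))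

/-- The sentence `∀ x₀ e(x₀)`. -/
noncomputable def sentence (D : FinPointedFrame Λ) : (frameLang Λ).Sentence :=
  FirstOrder.Language.Formula.iAlls Unit (D.eFormula.relabel (Sum.inr : Unit → Empty ⊕ Unit))

/-- The class of Kripke frames defined by the sentence `∀ x₀ e(x₀)`. -/
def frameClass (D : FinPointedFrame Λ) : Set (KripkeFrame Λ) :=
  {F | F.W ⊨ D.sentence}

/-- Every point is reachable from the root by a directed path (possibly of length zero). -/
def IsRooted (D : FinPointedFrame Λ) : Prop :=
  ∀ y, Relation.ReflTransGen (fun x z => ∃ a, D.R a x z) D.root y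

/-- Deleting the edge `x Rₐ y`. -/
def deleteEdge (D : FinPointedFrame Λ) (a : Λ) (x y : D.W) : FinPointedFrame Λ where
  W := D.W
  R b z w := D.R b z w ∧ ¬ (b = a ∧ z = x ∧ w = y)
  root := D.root
  finite_points := D.finite_points
  finite_edges := D.finite_edges.subset fun _ h => h.1

/-- No edge can be deleted so that `∀ x₀ e'(x₀)` for the resulting pointed frame still entails
`∀ x₀ e(x₀)` in first-order logic. -/
def GloballyMinimal (D : FinPointedFrame Λ) : Prop :=
  ∀ (a : Λ) (x y : D.W), D.R a x y →
    ¬ ((∅ : (frameLang Λ).Theory) ⊨ᵇ (D.deleteEdge a x y).sentence.imp D.sentence)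

/-- A step of an undirected path: along an edge `(a, true)`, or against an edge `(a, false)`. -/
def UStep (D : FinPointedFrame Λ) : Λ × Bool → D.W → D.W → Prop
  | (a, true), x, y => D.R a x y
  | (a, false), x, y => D.R a y x

/-- `z 0, ℓ 0, z 1, ℓ 1, …, ℓ (h - 1), z h` is an undirected cycle: a closed undirected path of
positive length without a segment that traverses an edge and at once goes back along it. -/
structure IsUndirectedCycle (D : FinPointedFrame Λ) (h : ℕ) (z : ℕ → D.W)
    (ℓ : ℕ → Λ × Bool) : Prop where
  pos : 0 < h
  closed : z 0 = z h
  step : ∀ i < h, D.UStep (ℓ i) (z i) (z (i + 1))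
  reduced : ∀ i, i + 1 < h → ¬ (ℓ (i + 1) = ((ℓ i).1, !(ℓ i).2) ∧ z (i + 2) = z i)

/-- There is an undirected cycle that does not pass through the root. -/
def HasInnerCycle (D : FinPointedFrame Λ) : Prop :=
  ∃ h z ℓ, D.IsUndirectedCycle h z ℓ ∧ ∀ i ≤ h, z i ≠ D.root

theorem realize_atom {α : Type u} (F : KripkeFrame Λ) (a : Λ) (x y : α) (v : α → F.W) :
    (atom a x y).Realize v ↔ F.R a (v x) (v y) :=
  FirstOrder.Language.Formula.realize_rel₂

/-- The first-order formula `e(x₀)` holds at `w` iff some homomorphism sends the root to `w`. -/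
theorem realize_eFormula (D : FinPointedFrame Λ) (F : KripkeFrame Λ) (w : F.W) :
    D.eFormula.Realize (fun _ => w) ↔
      ∃ f : D.W → F.W, f D.root = w ∧ ∀ a x y, D.R a x y → F.R a (f x) (f y) := by
  classical
  rw [eFormula, FirstOrder.Language.Formula.realize_iExs]
  simp only [FirstOrder.Language.Formula.realize_relabel, kFormula,
    FirstOrder.Language.Formula.realize_iInf, realize_atom]
  constructor
  · rintro ⟨i, hi⟩
    exact ⟨_, by simp, fun a x y h => hi ⟨(a, x, y), h⟩⟩
  · rintro ⟨f, rfl, hf⟩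
    refine ⟨fun x => f x.1, fun e => ?_⟩
    have key : ∀ x : D.W, Sum.elim (fun _ : Unit => f D.root)
        (fun x : {x : D.W // x ≠ D.root} => f x.1)
        (if h : x = D.root then Sum.inl () else Sum.inr ⟨x, h⟩) = f x := by
      intro x
      by_cases h : x = D.root <;> simp [h]
    simpa [key] using hf _ _ _ e.2

theorem realize_sentence (D : FinPointedFrame Λ) (F : KripkeFrame Λ) :
    F.W ⊨ D.sentence ↔
      ∀ w, ∃ f : D.W → F.W, f D.root = w ∧ ∀ a x y, D.R a x y → F.R a (f x) (f y) := by
  rw [FirstOrder.Language.Sentence.Realize, sentence, FirstOrder.Language.Formula.realize_iAlls]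
  simp only [FirstOrder.Language.Formula.realize_relabel, ← realize_eFormula]
  constructor
  · exact fun h w => h fun _ => w
  · exact fun h i => h (i ())

end FinPointedFrame

/-- A diagram: a finite pointed Kripke frame all of whose points are reachable from the root. -/
structure Diagram (Λ : Type u) extends FinPointedFrame Λ where
  rooted : toFinPointedFrame.IsRooted

end ModalDiagram

/-! Canonicity rests on modal approximations of `e`: `approx n` says that, for some assignment of
colours in `n` variables to the points of the diagram, its unravelling can be followed to depth `n`
with these colours. This holds wherever a homomorphism from the diagram exists. Conversely, in the
canonical frame of a normal logic containing all approximations, an ultrafilter limit turns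
approximate homomorphisms into genuine ones (`IsRooted.canonicalFrame_mem`). Hence `L` is canonical,
and the approximations axiomatise it.

For the second claim, minimality yields a finite frame containing the diagram in which only the root
is at issue and every homomorphism at the root must use all edges of the diagram (`Envelope`).
Multiply the non-root points by the vertices of a graph `G`, and let one edge from `y` to `z` on the
inner cycle move along the edges of `G` (`twist`). An approximation holds under a valuation if some
edge of `G` has ends with equal colours in all copies of the diagram's points (`sat_approx_twist`).
With enough variables to encode a proper colouring it can be refuted (`exists_not_valid`): the rest
of the cycle leads from `y` to `z` with the vertex colour unchanged, whereas the twisted edge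
changes it. Thus chromatic properties of `G` control validity.

Suppose only finitely many axioms are non-canonical. They follow from approximations whose
colourings use at most `K` colours. Some `approx n` fails whenever `G` is `(K + 2)`-colourable; it
follows from finitely many axioms, which in turn follow from approximations with at most `N`
colours. Take `G` on a compact zero-dimensional space with no proper `K`-colouring, no clopen proper
`N`-colouring, but a proper `(K + 2)`-colouring (`exists_graph`). These axioms hold in the general
frame of clopen sets. The canonical ones pass to the Kripke frame
(`IsCanonicalFormula.valid_of_clopen`); the others hold there since `G` is not `K`-colourable. So
`approx n` is valid, a contradiction. -/

namespace ModalDiagram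

open ModalFormula

/-! ### Normal logics, maximal consistent sets and the canonical frame -/

section Logic

variable {Λ : Type u}

/-- `v` is a truth assignment respecting `⊥` and `→`. -/
def IsBoolean (v : ModalFormula Λ → Prop) : Prop :=
  ¬ v bot ∧ ∀ ψ χ, v (imp ψ χ) ↔ (v ψ → v χ)

theorem IsBoolean.foldr {v : ModalFormula Λ → Prop} (hv : IsBoolean v) (ψ : ModalFormula Λ)
    (l : List (ModalFormula Λ)) : v (l.foldr imp ψ) ↔ ((∀ χ ∈ l, v χ) → v ψ) := by
  induction l with
  | nil => simp
  | cons a l ih => simp [hv.2, ih]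

theorem IsBoolean.neg {v : ModalFormula Λ → Prop} (hv : IsBoolean v) (ψ : ModalFormula Λ) :
    v (neg ψ) ↔ ¬ v ψ := by
  simp [ModalFormula.neg, hv.2, hv.1]

variable {L : Set (ModalFormula Λ)}

theorem IsNormalLogic.mp_list (hL : IsNormalLogic L) (ψ : ModalFormula Λ) :
    ∀ l : List (ModalFormula Λ), (∀ χ ∈ l, χ ∈ L) → l.foldr imp ψ ∈ L → ψ ∈ L
  | [], _, h => h
  | a :: l, hl, h => hL.mp_list ψ l (fun χ hχ => hl χ (List.mem_cons_of_mem _ hχ))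
      (hL.mp _ _ (hl a List.mem_cons_self) h)

/-- A normal logic is closed under propositional consequence. -/
theorem IsNormalLogic.consequence (hL : IsNormalLogic L) (l : List (ModalFormula Λ))
    {ψ : ModalFormula Λ} (hl : ∀ χ ∈ l, χ ∈ L)
    (h : ∀ v, IsBoolean v → (∀ χ ∈ l, v χ) → v ψ) : ψ ∈ L :=
  hL.mp_list ψ l hl (hL.taut _ fun v h0 h1 =>
    (IsBoolean.foldr ⟨h0, h1⟩ ψ l).2 (h v ⟨h0, h1⟩))

/-- By maximality `insert φ Δ` is inconsistent; discharging all occurrences of `φ` in the refutation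
is purely propositional. -/
theorem IsNormalLogic.refute_of_notMem (hL : IsNormalLogic L) {Δ : Set (ModalFormula Λ)}
    (hΔ : Maximal (Consistent L) Δ) {φ : ModalFormula Λ} (hφ : φ ∉ Δ) :
    ∃ l : List (ModalFormula Λ), (∀ χ ∈ l, χ ∈ Δ) ∧ l.foldr imp (neg φ) ∈ L := by
  classical
  have h : ¬ Consistent L (insert φ Δ) := fun hc =>
    hφ (hΔ.2 hc (Set.subset_insert _ _) (Set.mem_insert _ _))
  obtain ⟨l, hl, hlL⟩ := not_not.1 h
  refine ⟨l.filter (· ≠ φ), ?_, ?_⟩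
  · intro χ hχ
    simp only [ne_eq, decide_not, List.mem_filter, Bool.not_eq_eq_eq_not, Bool.not_true,
      decide_eq_false_iff_not] at hχ
    exact (hl χ hχ.1).resolve_left hχ.2
  · refine hL.consequence [l.foldr imp bot] (by simpa using hlL) fun v hv h => ?_
    simp only [List.mem_singleton, forall_eq, hv.foldr, hv.1, imp_false] at h
    rw [hv.foldr, hv.neg]
    intro h1 h2
    refine h fun χ hχ => ?_
    by_cases e : χ = φ
    · exact e ▸ h2
    · exact h1 χ (by simp [hχ, e])

theorem IsNormalLogic.mem_of_derivable (hL : IsNormalLogic L) {Δ : Set (ModalFormula Λ)}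
    (hΔ : Maximal (Consistent L) Δ) {ψ : ModalFormula Λ} (l : List (ModalFormula Λ))
    (hl : ∀ χ ∈ l, χ ∈ Δ) (h : l.foldr imp ψ ∈ L) : ψ ∈ Δ := by
  by_contra hψ
  obtain ⟨l', hl', h'⟩ := hL.refute_of_notMem hΔ hψ
  refine hΔ.1 ⟨l ++ l', fun χ hχ => (List.mem_append.1 hχ).elim (hl χ) (hl' χ), ?_⟩
  refine hL.consequence [l.foldr imp ψ, l'.foldr imp (neg ψ)] ?_ fun v hv h => ?_
  · simp [h, h']
  · simp only [List.mem_cons, List.not_mem_nil, or_false, forall_eq_or_imp, forall_eq, hv.foldr,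
      hv.neg] at h
    rw [hv.foldr]
    intro h3
    exact absurd (h.1 fun χ hχ => h3 χ (by simp [hχ])) (h.2 fun χ hχ => h3 χ (by simp [hχ]))

theorem IsNormalLogic.mem_of_entails (hL : IsNormalLogic L) {Δ : Set (ModalFormula Λ)}
    (hΔ : Maximal (Consistent L) Δ) {ψ : ModalFormula Λ} (l : List (ModalFormula Λ))
    (hl : ∀ χ ∈ l, χ ∈ Δ) (h : ∀ v, IsBoolean v → (∀ χ ∈ l, v χ) → v ψ) : ψ ∈ Δ :=
  hL.mem_of_derivable hΔ l hl (hL.taut _ fun v h0 h1 =>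
    (IsBoolean.foldr ⟨h0, h1⟩ ψ l).2 (h v ⟨h0, h1⟩))

/-- The maximal `L`-consistent sets are the supersets of `L` whose membership predicate respects
`⊥` and `→`. -/
theorem IsNormalLogic.maximal_iff (hL : IsNormalLogic L) (Δ : Set (ModalFormula Λ)) :
    Maximal (Consistent L) Δ ↔ L ⊆ Δ ∧ IsBoolean (· ∈ Δ) := by
  constructor
  · intro hΔ
    refine ⟨fun φ hφ => hL.mem_of_derivable hΔ [] (by simp) hφ, ?_, fun ψ χ => ⟨?_, ?_⟩⟩
    · intro h
      refine hΔ.1 ⟨[bot], by simpa using h, hL.taut _ fun v _ h1 => (h1 _ _).2 id⟩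
    · intro h1 h2
      refine hL.mem_of_entails hΔ [imp ψ χ, ψ] (by simp [h1, h2]) fun v hv h => ?_
      simp only [List.mem_cons, List.not_mem_nil, or_false, forall_eq_or_imp, forall_eq,
        hv.2] at h
      exact h.1 h.2
    · intro h
      by_cases h1 : ψ ∈ Δ
      · exact hL.mem_of_entails hΔ [χ] (by simp [h h1]) fun v hv h => (hv.2 _ _).2 fun _ => by
          simpa using h
      · obtain ⟨l, hl, h2⟩ := hL.refute_of_notMem hΔ h1
        have h3 := hL.mem_of_derivable hΔ l hl h2
        refine hL.mem_of_entails hΔ [neg ψ] (by simp [h3]) fun v hv h => (hv.2 _ _).2 fun h4 => ?_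
        simp only [List.mem_singleton, forall_eq, hv.neg] at h
        exact absurd h4 h
  · rintro ⟨hLΔ, hv⟩
    refine ⟨?_, fun Δ' hc hsub φ hφ => ?_⟩
    · rintro ⟨l, hl, h⟩
      exact hv.1 ((hv.foldr _ _).1 (hLΔ h) hl)
    · by_contra h
      have h1 : neg φ ∈ Δ := (hv.neg φ).2 h
      refine hc ⟨[φ, neg φ], by simp [hφ, hsub h1], hL.taut _ fun v h0 h1 => ?_⟩
      exact (IsBoolean.foldr ⟨h0, h1⟩ _ _).2 fun h => by
        simp only [List.mem_cons, List.not_mem_nil, or_false, forall_eq_or_imp, forall_eq,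
          IsBoolean.neg ⟨h0, h1⟩] at h
        exact absurd h.1 h.2

/-- Lindenbaum's lemma. -/
theorem Consistent.exists_maximal {Δ : Set (ModalFormula Λ)} (hΔ : Consistent L Δ) :
    ∃ Θ, Δ ⊆ Θ ∧ Maximal (Consistent L) Θ := by
  refine zorn_subset_nonempty {Θ | Consistent L Θ} ?_ Δ hΔ
  intro c hc hchain hne
  refine ⟨⋃₀ c, ?_, fun s hs => Set.subset_sUnion_of_mem hs⟩
  rintro ⟨l, hl, h⟩
  obtain ⟨s, hs, hls⟩ : ∃ s ∈ c, ∀ φ ∈ l, φ ∈ s := by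
    clear h
    induction l with
    | nil => exact ⟨hne.some, hne.some_mem, by simp⟩
    | cons a l ih =>
      obtain ⟨s, hs, h1⟩ := ih fun φ hφ => hl φ (List.mem_cons_of_mem _ hφ)
      obtain ⟨t, ht, h2⟩ := hl a List.mem_cons_self
      rcases hchain.total hs ht with h3 | h3
      · exact ⟨t, ht, by simpa [h2] using fun φ hφ => h3 (h1 φ hφ)⟩
      · exact ⟨s, hs, by simpa [h3 h2] using h1⟩
  exact hc hs ⟨l, hls, h⟩

theorem IsNormalLogic.box_mp (hL : IsNormalLogic L) (a : Λ) (φ ψ : ModalFormula Λ) :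
    imp (box a (imp φ ψ)) (imp (box a φ) (box a ψ)) ∈ L :=
  hL.subst (fun n => if n = 0 then φ else ψ) _ (hL.axiomK a)

theorem IsNormalLogic.dia_imp (hL : IsNormalLogic L) (a : Λ) (φ : ModalFormula Λ) :
    imp (dia a φ) (neg (box a (neg φ))) ∈ L :=
  hL.subst (fun _ => φ) _ (hL.dual_mp a)

theorem IsNormalLogic.imp_dia (hL : IsNormalLogic L) (a : Λ) (φ : ModalFormula Λ) :
    imp (neg (box a (neg φ))) (dia a φ) ∈ L :=
  hL.subst (fun _ => φ) _ (hL.dual_mpr a)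

theorem IsNormalLogic.box_foldr (hL : IsNormalLogic L) (a : Λ) (ψ : ModalFormula Λ)
    (l : List (ModalFormula Λ)) (Δ : Set (ModalFormula Λ)) (hΔ : L ⊆ Δ)
    (hv : IsBoolean (· ∈ Δ)) (hl : ∀ χ ∈ l, box a χ ∈ Δ) (h : box a (l.foldr imp ψ) ∈ Δ) :
    box a ψ ∈ Δ := by
  induction l with
  | nil => exact h
  | cons χ l ih =>
    refine ih (fun χ hχ => hl χ (List.mem_cons_of_mem _ hχ)) ?_
    exact (hv.2 _ _).1 ((hv.2 _ _).1 (hΔ (hL.box_mp a _ _)) h) (hl χ List.mem_cons_self)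

/-- The existence lemma for canonical frames. -/
theorem IsNormalLogic.exists_successor (hL : IsNormalLogic L) (Δ : (canonicalFrame L).W) (a : Λ)
    (φ : ModalFormula Λ) (h : dia a φ ∈ Δ.1) :
    ∃ Θ : (canonicalFrame L).W, (canonicalFrame L).R a Δ Θ ∧ φ ∈ Θ.1 := by
  classical
  obtain ⟨hsub, hv⟩ := (hL.maximal_iff _).1 Δ.2
  have hc : Consistent L (insert φ {ψ | box a ψ ∈ Δ.1}) := by
    rintro ⟨l, hl, hlL⟩
    have h1 : (l.filter (· ≠ φ)).foldr imp (neg φ) ∈ L := by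
      refine hL.consequence [l.foldr imp bot] (by simpa using hlL) fun v hv h => ?_
      simp only [List.mem_singleton, forall_eq, hv.foldr, hv.1, imp_false] at h
      rw [hv.foldr, hv.neg]
      intro h1 h2
      refine h fun χ hχ => ?_
      by_cases e : χ = φ
      · exact e ▸ h2
      · exact h1 χ (by simp [hχ, e])
    have h2 : box a (neg φ) ∈ Δ.1 := by
      refine hL.box_foldr a _ _ Δ.1 hsub hv ?_ (hsub (hL.nec a _ h1))
      intro χ hχ
      simp only [ne_eq, decide_not, List.mem_filter, Bool.not_eq_eq_eq_not, Bool.not_true,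
        decide_eq_false_iff_not] at hχ
      exact (hl χ hχ.1).resolve_left hχ.2
    exact (hv.neg _).1 ((hv.2 _ _).1 (hsub (hL.dia_imp a φ)) h) h2
  obtain ⟨Θ, hΘ, hmax⟩ := hc.exists_maximal
  obtain ⟨-, hv'⟩ := (hL.maximal_iff _).1 hmax
  refine ⟨⟨Θ, hmax⟩, fun ψ hψ => ?_, hΘ (Set.mem_insert _ _)⟩
  refine (hv.2 _ _).1 (hsub (hL.imp_dia a ψ)) ((hv.neg _).2 fun hb => ?_)
  exact (hv'.neg ψ).1 (hΘ (Set.mem_insert_of_mem _ hb)) hψ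

/-- The truth lemma for canonical frames, under the valuation given by a substitution. -/
theorem IsNormalLogic.sat_canonicalFrame (hL : IsNormalLogic L) (σ : ℕ → ModalFormula Λ)
    (ψ : ModalFormula Λ) (Δ : (canonicalFrame L).W) :
    (canonicalFrame L).Sat (fun p => {Θ | σ p ∈ Θ.1}) Δ ψ ↔ ψ.subst σ ∈ Δ.1 := by
  induction ψ generalizing Δ with
  | var p => rfl
  | bot => exact iff_of_false id ((hL.maximal_iff _).1 Δ.2).2.1
  | imp φ ψ h1 h2 =>
    exact (imp_congr (h1 Δ) (h2 Δ)).trans (((hL.maximal_iff _).1 Δ.2).2.2 _ _).symm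
  | dia a φ ih =>
    constructor
    · rintro ⟨Θ, h1, h2⟩
      exact h1 _ ((ih Θ).1 h2)
    · intro h
      obtain ⟨Θ, h1, h2⟩ := hL.exists_successor Δ a _ h
      exact ⟨Θ, h1, (ih Θ).2 h2⟩

theorem ModalFormula.subst_var (ψ : ModalFormula Λ) : ψ.subst var = ψ := by
  induction ψ <;> simp_all [ModalFormula.subst]

/-- A formula valid in the canonical frame of a normal logic belongs to the logic. -/
theorem IsNormalLogic.mem_of_valid (hL : IsNormalLogic L) {φ : ModalFormula Λ}
    (h : (canonicalFrame L).Valid φ) : φ ∈ L := by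
  by_contra hφ
  have hc : Consistent L {neg φ} := by
    rintro ⟨l, hl, hlL⟩
    refine hφ (hL.consequence [l.foldr imp bot] (by simpa using hlL) fun v hv h => ?_)
    simp only [List.mem_singleton, forall_eq, hv.foldr, hv.1, imp_false] at h
    by_contra h1
    exact h fun χ hχ => (hl χ hχ : χ = neg φ) ▸ (hv.neg φ).2 h1
  obtain ⟨Θ, hΘ, hmax⟩ := hc.exists_maximal
  have h1 := (hL.sat_canonicalFrame var φ ⟨Θ, hmax⟩).1 (h _ _)
  rw [ModalFormula.subst_var] at h1
  exact (((hL.maximal_iff _).1 hmax).2.neg φ).1 (hΘ rfl) h1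

theorem isNormalLogic_KPlus (Γ : Set (ModalFormula Λ)) : IsNormalLogic (KPlus Γ) :=
  (axiomatises_KPlus Γ).1.1

theorem KPlus_subset {Γ : Set (ModalFormula Λ)} (hL : IsNormalLogic L) (h : Γ ⊆ L) :
    KPlus Γ ⊆ L :=
  (axiomatises_KPlus Γ).2 ⟨hL, h⟩

theorem subset_KPlus (Γ : Set (ModalFormula Λ)) : Γ ⊆ KPlus Γ :=
  (axiomatises_KPlus Γ).1.2

theorem KPlus_mono {Γ Γ' : Set (ModalFormula Λ)} (h : Γ ⊆ Γ') : KPlus Γ ⊆ KPlus Γ' :=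
  KPlus_subset (isNormalLogic_KPlus _) (h.trans (subset_KPlus _))

/-- Derivations are finite. -/
theorem exists_finite_of_mem_KPlus {Γ : Set (ModalFormula Λ)} {φ : ModalFormula Λ}
    (h : φ ∈ KPlus Γ) : ∃ Γ₀ ⊆ Γ, Γ₀.Finite ∧ φ ∈ KPlus Γ₀ := by
  have hN : ∀ Γ₀ : Set (ModalFormula Λ), IsNormalLogic (KPlus Γ₀) := isNormalLogic_KPlus
  have hE : ∀ φ : ModalFormula Λ, φ ∈ KPlus ∅ → ∃ Γ₀ ⊆ Γ, Γ₀.Finite ∧ φ ∈ KPlus Γ₀ :=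
    fun φ h => ⟨∅, Set.empty_subset _, Set.finite_empty, h⟩
  refine KPlus_subset (L := {φ | ∃ Γ₀ ⊆ Γ, Γ₀.Finite ∧ φ ∈ KPlus Γ₀})
    ⟨fun φ h => hE _ ((hN _).taut φ h), fun a => hE _ ((hN _).axiomK a),
      fun a => hE _ ((hN _).dual_mp a), fun a => hE _ ((hN _).dual_mpr a), ?_, ?_, ?_⟩ ?_ h
  · rintro φ ψ ⟨A, hA, fA, h1⟩ ⟨B, hB, fB, h2⟩
    exact ⟨A ∪ B, Set.union_subset hA hB, fA.union fB, (hN _).mp _ _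
      (KPlus_mono Set.subset_union_left h1) (KPlus_mono Set.subset_union_right h2)⟩
  · rintro σ φ ⟨A, hA, fA, h1⟩
    exact ⟨A, hA, fA, (hN _).subst σ _ h1⟩
  · rintro a φ ⟨A, hA, fA, h1⟩
    exact ⟨A, hA, fA, (hN _).nec a _ h1⟩
  · exact fun φ hφ => ⟨{φ}, by simpa using hφ, Set.finite_singleton _, subset_KPlus _ rfl⟩

/-! ### General frames -/

/-- A family of sets closed under the operations that interpret `⊥`, `→` and the diamonds. -/
structure IsModalAlgebra (F : KripkeFrame Λ) (A : Set (Set F.W)) : Prop where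
  bot : ∅ ∈ A
  imp : ∀ U ∈ A, ∀ V ∈ A, {x | x ∈ U → x ∈ V} ∈ A
  dia : ∀ a, ∀ U ∈ A, {x | ∃ y, F.R a x y ∧ y ∈ U} ∈ A

/-- The formulas true at all points under all valuations in `A`. -/
def generalLog (F : KripkeFrame Λ) (A : Set (Set F.W)) : Set (ModalFormula Λ) :=
  {φ | ∀ θ : ℕ → Set F.W, (∀ p, θ p ∈ A) → ∀ x, F.Sat θ x φ}

theorem IsModalAlgebra.univ (F : KripkeFrame Λ) : IsModalAlgebra F Set.univ :=
  ⟨trivial, fun _ _ _ _ => trivial, fun _ _ _ => trivial⟩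

theorem IsModalAlgebra.sat_mem {F : KripkeFrame Λ} {A : Set (Set F.W)} (hA : IsModalAlgebra F A)
    {θ : ℕ → Set F.W} (hθ : ∀ p, θ p ∈ A) (φ : ModalFormula Λ) : {x | F.Sat θ x φ} ∈ A := by
  induction φ with
  | var p => exact hθ p
  | bot => exact hA.bot
  | imp φ ψ h1 h2 => exact hA.imp _ h1 _ h2
  | dia a φ ih => exact hA.dia a _ ih

theorem KripkeFrame.sat_subst (F : KripkeFrame Λ) (θ : ℕ → Set F.W) (σ : ℕ → ModalFormula Λ)
    (φ : ModalFormula Λ) (x : F.W) :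
    F.Sat θ x (φ.subst σ) ↔ F.Sat (fun p => {y | F.Sat θ y (σ p)}) x φ := by
  induction φ generalizing x with
  | var p => rfl
  | bot => rfl
  | imp φ ψ h1 h2 => exact imp_congr (h1 x) (h2 x)
  | dia a φ ih => exact exists_congr fun y => and_congr_right fun _ => ih y

theorem KripkeFrame.isBoolean_sat (F : KripkeFrame Λ) (θ : ℕ → Set F.W) (x : F.W) :
    IsBoolean (F.Sat θ x) :=
  ⟨id, fun _ _ => Iff.rfl⟩

theorem KripkeFrame.sat_neg (F : KripkeFrame Λ) (θ : ℕ → Set F.W) (x : F.W)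
    (φ : ModalFormula Λ) : F.Sat θ x (neg φ) ↔ ¬ F.Sat θ x φ :=
  Iff.rfl

theorem KripkeFrame.sat_box (F : KripkeFrame Λ) (θ : ℕ → Set F.W) (x : F.W) (a : Λ)
    (φ : ModalFormula Λ) : F.Sat θ x (box a φ) ↔ ∀ y, F.R a x y → F.Sat θ y φ := by
  constructor
  · intro h y hy
    by_contra hn
    exact h ⟨y, hy, hn⟩
  · rintro h ⟨y, hy, hn⟩
    exact hn (h y hy)

theorem IsModalAlgebra.isNormalLogic {F : KripkeFrame Λ} {A : Set (Set F.W)}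
    (hA : IsModalAlgebra F A) : IsNormalLogic (generalLog F A) where
  taut φ h θ _ x := h _ (F.isBoolean_sat θ x).1 (F.isBoolean_sat θ x).2
  axiomK a θ _ x h1 h2 := by
    rw [F.sat_box] at h1 h2 ⊢
    exact fun y hy => h1 y hy (h2 y hy)
  dual_mp a θ _ x := by
    rintro ⟨y, hy, h⟩ hb
    exact (F.sat_box θ x a _).1 hb y hy h
  dual_mpr a θ _ x h := by
    rw [F.sat_neg, F.sat_box] at h
    push Not at h
    obtain ⟨y, hy, h⟩ := h
    exact ⟨y, hy, not_not.1 h⟩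
  mp φ ψ h1 h2 θ hθ x := h2 θ hθ x (h1 θ hθ x)
  subst σ φ h θ hθ x := (F.sat_subst θ σ φ x).2 (h _ (fun p => hA.sat_mem hθ (σ p)) x)
  nec a φ h θ hθ x := (F.sat_box θ x a φ).2 fun y _ => h θ hθ y

theorem mem_generalLog_univ {F : KripkeFrame Λ} {φ : ModalFormula Λ} :
    φ ∈ generalLog F Set.univ ↔ F.Valid φ :=
  ⟨fun h θ x => h θ (fun _ => trivial) x, fun h θ _ x => h θ x⟩

theorem isNormalLogic_Log (C : Set (KripkeFrame Λ)) : IsNormalLogic (Log C) := by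
  have hN : ∀ F : KripkeFrame Λ, IsNormalLogic (generalLog F Set.univ) :=
    fun F => (IsModalAlgebra.univ F).isNormalLogic
  have hm : ∀ {φ : ModalFormula Λ}, φ ∈ Log C ↔ ∀ F ∈ C, φ ∈ generalLog F Set.univ := by
    simp [Log, mem_generalLog_univ]
  constructor
  · exact fun φ h => hm.2 fun F _ => (hN F).taut φ h
  · exact fun a => hm.2 fun F _ => (hN F).axiomK a
  · exact fun a => hm.2 fun F _ => (hN F).dual_mp a
  · exact fun a => hm.2 fun F _ => (hN F).dual_mpr a
  · exact fun φ ψ h1 h2 => hm.2 fun F hF => (hN F).mp φ ψ (hm.1 h1 F hF) (hm.1 h2 F hF)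
  · exact fun σ φ h => hm.2 fun F hF => (hN F).subst σ φ (hm.1 h F hF)
  · exact fun a φ h => hm.2 fun F hF => (hN F).nec a φ (hm.1 h F hF)

end Logic

end ModalDiagram

namespace ModalDiagram

variable {Λ : Type u}

/-! ### Minimality -/

/-- If `D` is globally minimal, then for every edge some frame satisfies `∀ x₀ e'(x₀)` for the
diagram without the edge, but not `∀ x₀ e(x₀)`. -/
theorem FinPointedFrame.GloballyMinimal.exists_frame {D : FinPointedFrame Λ}
    (hmin : D.GloballyMinimal) {a : Λ} {x y : D.W} (h : D.R a x y) :
    ∃ F : KripkeFrame Λ, F ∈ (D.deleteEdge a x y).frameClass ∧ F ∉ D.frameClass := by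
  have h1 := hmin a x y h
  rw [Language.Theory.models_sentence_iff] at h1
  push Not at h1
  obtain ⟨N, hN⟩ := h1
  let F : KripkeFrame Λ := ⟨N, fun a x y => Language.Structure.RelMap
    (L := frameLang Λ) (n := 2) (FrameRel.rel a) ![x, y]⟩
  -- There are no function symbols, so the binary relations recover the whole structure.
  have hs : F.structure = (N.struc : (frameLang Λ).Structure N) := by
    refine Language.Structure.ext ?_ ?_
    · funext n f
      exact f.elim
    · funext n r v
      cases r with
      | rel a =>
        have : v = ![v 0, v 1] := by
          funext i
          fin_cases i <;> rfl
        conv_rhs => rw [this]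
        rfl
  have hr : ∀ φ : (frameLang Λ).Sentence,
      @Language.Sentence.Realize _ F.W F.structure φ ↔ N ⊨ φ := by
    intro φ
    rw [hs]
  refine ⟨F, ?_, ?_⟩
  · refine (hr _).2 ?_
    by_contra hc
    exact hN fun h => absurd h hc
  · intro hF
    exact hN fun _ => (hr _).1 hF

namespace FinPointedFrame

variable (D : FinPointedFrame Λ)

/-- A homomorphism from `D` into the frame with relations `R` that sends the root to `w`. -/
def HomAt {W : Type*} (R : Λ → W → W → Prop) (w : W) (f : D.W → W) : Prop :=
  f D.root = w ∧ ∀ a x y, D.R a x y → R a (f x) (f y)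

theorem mem_frameClass {F : KripkeFrame Λ} :
    F ∈ D.frameClass ↔ ∀ w, ∃ f, D.HomAt F.R w f :=
  D.realize_sentence F

/-! ### The free frame over a diagram -/

/-- The points of `D` besides the root. -/
abbrev NonRoot : Type u := {x : D.W // x ≠ D.root}

open Classical in
/-- The point `x` of the copy of `D` attached at `p`. -/
noncomputable def node (p : List D.NonRoot) (x : D.W) : List D.NonRoot :=
  if h : x = D.root then p else ⟨x, h⟩ :: p

variable {D}

@[simp] theorem node_root (p : List D.NonRoot) : D.node p D.root = p := by simp [node]

theorem node_of_ne (p : List D.NonRoot) {x : D.W} (h : x ≠ D.root) :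
    D.node p x = ⟨x, h⟩ :: p := by simp [node, h]

@[simp] theorem node_nonRoot (p : List D.NonRoot) (x : D.NonRoot) :
    D.node p x.1 = x :: p := by simp [node, x.2]

theorem node_append (p q : List D.NonRoot) (x : D.W) :
    D.node (p ++ q) x = D.node p x ++ q := by
  by_cases h : x = D.root
  · simp [h]
  · simp [node_of_ne _ h]

theorem length_le_node (p : List D.NonRoot) (x : D.W) : p.length ≤ (D.node p x).length := by
  by_cases h : x = D.root
  · simp [h]
  · simp [node_of_ne _ h]

theorem length_node_le (p : List D.NonRoot) (x : D.W) : (D.node p x).length ≤ p.length + 1 := by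
  by_cases h : x = D.root
  · simp [h]
  · simp [node_of_ne _ h]

variable (D)

/-- The edges of the free frame on one point in which a copy of `D` is attached to every point,
where the copies at the points of depth less than `j` lack the edge `e`. -/
def ChaseRel (e : Λ × D.W × D.W) (j : ℕ) (a : Λ) (s t : List D.NonRoot) : Prop :=
  ∃ p x y, D.R a x y ∧ (p.length < j → (a, x, y) ≠ e) ∧ s = D.node p x ∧ t = D.node p y

variable {D} {e : Λ × D.W × D.W}

/-- Homomorphisms from `D` stay within bounded depth. -/
theorem IsRooted.exists_length_le (hD : D.IsRooted) :
    ∃ B : ℕ, ∀ {W : Type u} (R : Λ → W → W → Prop) (len : W → ℕ),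
      (∀ a s t, R a s t → len t ≤ len s + 1) → ∀ w f, len w = 0 → D.HomAt R w f →
        ∀ x, len (f x) ≤ B := by
  classical
  have h : ∀ x, ∃ n : ℕ, ∀ {W : Type u} (R : Λ → W → W → Prop) (len : W → ℕ),
      (∀ a s t, R a s t → len t ≤ len s + 1) → ∀ w f, len w = 0 → D.HomAt R w f →
        len (f x) ≤ n := by
    intro x
    induction hD x with
    | refl => exact ⟨0, fun R len _ w f hw hf => by rw [hf.1, hw]⟩
    | tail _ h ih =>
      obtain ⟨n, hn⟩ := ih
      obtain ⟨a, ha⟩ := h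
      exact ⟨n + 1, fun R len hR w f hw hf => (hR a _ _ (hf.2 a _ _ ha)).trans
        (Nat.succ_le_succ (hn R len hR w f hw hf))⟩
  choose n hn using h
  obtain ⟨B, hB⟩ := (Set.finite_range n).bddAbove
  exact ⟨B, fun R len hR w f hw hf x => (hn x R len hR w f hw hf).trans (hB ⟨x, rfl⟩)⟩

theorem ChaseRel.length_le {j : ℕ} {a : Λ} {s t : List D.NonRoot} (h : D.ChaseRel e j a s t) :
    t.length ≤ s.length + 1 := by
  obtain ⟨p, x, y, -, -, rfl, rfl⟩ := h
  exact (length_node_le p y).trans (Nat.succ_le_succ (length_le_node p x))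

/-- If the copy at the bottom does not need the edge `e`, then the edge can be omitted up to any
given depth. -/
theorem exists_homAt_chase {h : D.W → List D.NonRoot} (hh : D.HomAt (D.ChaseRel e 1) [] h) :
    ∀ j, ∃ f, D.HomAt (D.ChaseRel e j) [] f
  | 0 => ⟨D.node [], node_root _, fun a x y hxy => ⟨[], x, y, hxy, fun h => by simp at h, rfl, rfl⟩⟩
  | j + 1 => by
    obtain ⟨f, hf0, hf⟩ := exists_homAt_chase hh j
    -- `G` fixes the bottom copy and maps the copy at `p ≠ []` by `f`, shifted to start at `G p`. As
    -- `G p ≠ []`, the shift gains at least one level, so omission below depth `j` becomes omission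
    -- below `j + 1`.
    let G : List D.NonRoot → List D.NonRoot := List.rec [] fun x p g =>
      if p = [] then [x] else f x.1 ++ g
    have G1 : ∀ x, G (D.node [] x) = D.node [] x := by
      intro x
      by_cases hx : x = D.root
      · simp [hx, G]
      · simp [node_of_ne _ hx, G]
    have G2 : ∀ p, p ≠ [] → ∀ x, G (D.node p x) = f x ++ G p := by
      intro p hp x
      by_cases hx : x = D.root
      · simp [hx, hf0]
      · rw [node_of_ne _ hx]
        exact if_neg hp
    have G3 : ∀ p, p ≠ [] → G p ≠ [] := by
      intro p
      induction p with
      | nil => exact fun h => absurd rfl h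
      | cons x p ih =>
        intro _
        by_cases hp : p = []
        · subst hp
          simp [G]
        · have := G2 p hp x.1
          rw [node_nonRoot] at this
          simp [this, ih hp]
    refine ⟨G ∘ h, by simp [hh.1, G], fun a x y hxy => ?_⟩
    obtain ⟨p, x', y', hR, hne, hx, hy⟩ := hh.2 a x y hxy
    simp only [Function.comp_apply, hx, hy]
    by_cases hp : p = []
    · subst hp
      exact ⟨[], x', y', hR, fun _ => hne (by simp), by rw [G1], by rw [G1]⟩
    · rw [G2 p hp, G2 p hp]
      obtain ⟨q, x'', y'', hR', hne', hx', hy'⟩ := hf a x' y' hR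
      refine ⟨q ++ G p, x'', y'', hR', fun hl => hne' ?_, ?_, ?_⟩
      · have := List.length_pos_iff.2 (G3 p hp)
        rw [List.length_append] at hl
        omega
      · rw [node_append, hx']
      · rw [node_append, hy']

/-- In a globally minimal diagram, a homomorphism into the free frame over the diagram has to
use every edge of the copy at the bottom. -/
theorem GloballyMinimal.not_homAt_chase (hmin : D.GloballyMinimal) (hD : D.IsRooted) {c : Λ}
    {y z : D.W} (hyz : D.R c y z) (h : D.W → List D.NonRoot) :
    ¬ D.HomAt (D.ChaseRel (c, y, z) 1) [] h := by
  intro hh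
  obtain ⟨F, hF1, hF2⟩ := hmin.exists_frame hyz
  rw [mem_frameClass] at hF1 hF2
  refine hF2 fun w => ?_
  choose m hm using hF1
  obtain ⟨B, hB⟩ := hD.exists_length_le
  -- The values of `f` have length at most `B`, so all edges used lie in copies attached at depth
  -- below `B + 1`, where the edge is missing.
  obtain ⟨f, hf⟩ := exists_homAt_chase hh (B + 1)
  have hlen := hB (D.ChaseRel (c, y, z) (B + 1)) List.length
    (fun _ _ _ h => h.length_le) [] f rfl hf
  -- Freeness: the chosen homomorphisms `m` of the reduced diagram are iterated along the list.
  let g : List D.NonRoot → F.W := List.rec w fun x _ v => m v x.1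
  have hg : ∀ p x, g (D.node p x) = m (g p) x := by
    intro p x
    by_cases hx : x = D.root
    · rw [hx, node_root]
      exact (hm (g p)).1.symm
    · rw [node_of_ne _ hx]
  refine ⟨g ∘ f, by simp [hf.1, g], fun a x y hxy => ?_⟩
  obtain ⟨p, x', y', hR, hne, hx, hy⟩ := hf.2 a x y hxy
  simp only [Function.comp_apply, hx, hy, hg]
  refine (hm (g p)).2 a x' y' ⟨hR, fun he => hne ?_ (by simp [he])⟩
  have := length_le_node p x'
  have := hx ▸ hlen x
  omega

/-! ### Finite envelopes of minimal diagrams -/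

/-- The copy of `D` at the bottom of a frame whose root is `none`. -/
noncomputable def bottom {P : Type*} (ι : D.NonRoot → P) (x : D.W) : Option P :=
  open Classical in if h : x = D.root then none else some (ι ⟨x, h⟩)

@[simp] theorem bottom_root {P : Type*} (ι : D.NonRoot → P) : bottom ι D.root = none := by
  simp [bottom]

@[simp] theorem bottom_nonRoot {P : Type*} (ι : D.NonRoot → P) (x : D.NonRoot) :
    bottom ι x.1 = some (ι x) := by
  simp [bottom, x.2]

/-- A finite frame that contains `D` and in which all points but the root of `D` satisfy `e`, by
homomorphisms that avoid the root and the edges of `D`, while homomorphisms that send the root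
to the root use every edge of `D`. -/
structure Envelope (D : FinPointedFrame Λ) where
  /-- the points besides the root -/
  P : Type u
  finite : Finite P
  /-- the relations -/
  R : Λ → Option P → Option P → Prop
  /-- the embedding of `D` -/
  ι : D.NonRoot → P
  injective : Function.Injective ι
  homAt : D.HomAt R none (bottom ι)
  exists_homAt : ∀ s : P, ∃ f : D.W → P, f D.root = s ∧ ∀ a x y, D.R a x y →
    R a (some (f x)) (some (f y)) ∧ ∀ x' y', D.R a x' y' →
      ¬ (some (f x) = bottom ι x' ∧ some (f y) = bottom ι y')
  uses_edge : ∀ c y z, D.R c y z → ∀ f, D.HomAt R none f →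
    ∃ x x', D.R c x x' ∧ f x = bottom ι y ∧ f x' = bottom ι z

/-- The envelope is the free frame truncated at depth `B + 2`, with loops of every index at that
depth. Homomorphisms from the diagram at the root reach only depth `B`, so they cannot exploit the
loops. -/
theorem GloballyMinimal.nonempty_envelope (hmin : D.GloballyMinimal) (hD : D.IsRooted) :
    Nonempty D.Envelope := by
  classical
  obtain ⟨B, hB⟩ := hD.exists_length_le
  let P : Type u := {s : List D.NonRoot // s ≠ [] ∧ s.length ≤ B + 2}
  let val : Option P → List D.NonRoot := fun s => s.elim [] Subtype.val
  have hval : Function.Injective val := by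
    rintro (_ | s) (_ | t) h
    · rfl
    · exact absurd h.symm t.2.1
    · exact absurd h s.2.1
    · exact congrArg some (Subtype.ext h)
  have hvals : ∀ s : P, val (some s) = s.1 := fun _ => rfl
  let Rel : Λ → List D.NonRoot → List D.NonRoot → Prop := fun a s t =>
    (∃ p x y, D.R a x y ∧ s = D.node p x ∧ t = D.node p y) ∨ (s = t ∧ s.length = B + 2)
  let ι : D.NonRoot → P := fun x => ⟨[x], by simp, by simp⟩
  have hbot : ∀ x, val (bottom ι x) = D.node [] x := by
    intro x
    by_cases hx : x = D.root
    · simp [hx, val]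
    · rw [node_of_ne _ hx]
      simp [bottom, hx, val, ι]
  have huse : ∀ c y z, D.R c y z → ∀ f, D.HomAt (fun a s t => Rel a (val s) (val t)) none f →
      ∃ x x', D.R c x x' ∧ f x = bottom ι y ∧ f x' = bottom ι z := by
    intro c y z hyz f hf
    by_contra hc
    push Not at hc
    have hlen := hB (fun a s t => Rel a (val s) (val t)) (fun s => (val s).length) ?_ none f rfl hf
    · refine hmin.not_homAt_chase hD hyz (val ∘ f) ⟨by simp [hf.1, val], fun a x x' hxx' => ?_⟩
      rcases hf.2 a x x' hxx' with ⟨p, u, v, huv, hu, hv⟩ | ⟨-, h⟩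
      · refine ⟨p, u, v, huv, fun hp he => ?_, hu, hv⟩
        obtain rfl : p = [] := List.length_eq_zero_iff.1 (by omega)
        simp only [Prod.mk.injEq] at he
        obtain ⟨rfl, rfl, rfl⟩ := he
        exact hc x x' hxx' (hval (hu.trans (hbot _).symm)) (hval (hv.trans (hbot _).symm))
      · have := hlen x
        omega
    · rintro a s t (⟨p, u, v, huv, hu, hv⟩ | ⟨h, -⟩)
      · rw [hu, hv]
        exact (length_node_le p v).trans (Nat.succ_le_succ (length_le_node p u))
      · rw [h]
        omega
  refine ⟨⟨P, ?_, fun a s t => Rel a (val s) (val t), ι, ?_, ?_, ?_, huse⟩⟩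
  · exact ((List.finite_length_le D.NonRoot (B + 2)).subset fun s hs => hs.2).to_subtype
  · intro x y h
    simpa [ι] using congrArg (fun p : P => p.1) h
  · refine ⟨by simp, fun a x y h => Or.inl ⟨[], x, y, h, hbot x, hbot y⟩⟩
  · intro s
    rcases s.2.2.lt_or_eq with hs | hs
    · refine ⟨fun x => ⟨D.node s.1 x, ?_, (length_node_le _ _).trans hs⟩, by simp, ?_⟩
      · have h1 := List.length_pos_iff.2 s.2.1
        exact List.length_pos_iff.1 (h1.trans_le (length_le_node s.1 x))
      · intro a x y h
        refine ⟨Or.inl ⟨s.1, x, y, h, rfl, rfl⟩, fun x' y' h' he => ?_⟩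
        have hx := hbot x'
        have hy := hbot y'
        rw [← he.1, hvals] at hx
        rw [← he.2, hvals] at hy
        -- If the copy at `s` supplied an edge of the bottom copy, the identity of the bottom copy
        -- would not need that edge there, against minimality.
        refine hmin.not_homAt_chase hD h' (D.node []) ⟨node_root _, fun b u v huv => ?_⟩
        by_cases hb : (b, u, v) = (a, x', y')
        · simp only [Prod.mk.injEq] at hb
          obtain ⟨rfl, rfl, rfl⟩ := hb
          refine ⟨s.1, x, y, h, fun hl => ?_, hx.symm, hy.symm⟩
          have := List.length_pos_iff.2 s.2.1
          omega
        · exact ⟨[], u, v, huv, fun _ => hb, rfl, rfl⟩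
    · refine ⟨fun _ => s, rfl, fun a x y _ => ⟨Or.inr ⟨rfl, hs⟩, fun x' y' _ he => ?_⟩⟩
      have hx := hbot x'
      rw [← he.1, hvals] at hx
      have := length_node_le [] x'
      rw [← hx, hs] at this
      simp at this

end FinPointedFrame

end ModalDiagram

namespace ModalDiagram

open ModalFormula

variable {Λ : Type u}

/-! ### Modal approximations of `e` -/

namespace ModalFormula

/-- The conjunction of a list of formulas. -/
def conj (l : List (ModalFormula Λ)) : ModalFormula Λ := neg (l.foldr imp bot)

/-- The disjunction of a list of formulas. -/
def disj (l : List (ModalFormula Λ)) : ModalFormula Λ := (l.map neg).foldr imp bot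

end ModalFormula

namespace KripkeFrame

variable (F : KripkeFrame Λ) (θ : ℕ → Set F.W)

theorem sat_conj (w : F.W) (l : List (ModalFormula Λ)) :
    F.Sat θ w (conj l) ↔ ∀ φ ∈ l, F.Sat θ w φ := by
  rw [conj, F.sat_neg, (F.isBoolean_sat θ w).foldr]
  exact not_not

theorem sat_disj (w : F.W) (l : List (ModalFormula Λ)) :
    F.Sat θ w (disj l) ↔ ∃ φ ∈ l, F.Sat θ w φ := by
  rw [disj, (F.isBoolean_sat θ w).foldr]
  change ¬ (∀ χ ∈ _, _) ↔ _
  simp [F.sat_neg]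

/-- The colour of a point under the first `n` sets of a valuation. -/
def colour (n : ℕ) (w : F.W) : Fin n → Prop := fun i => w ∈ θ i

end KripkeFrame

namespace FinPointedFrame

variable (D : FinPointedFrame Λ)

open Classical in
/-- The formula saying that the unravelling of `D` at `x` up to depth `j` maps to the frame so
that colours are as given by `f`. -/
noncomputable def unravel {n : ℕ} (f : D.W → Fin n → Prop) : ℕ → D.W → ModalFormula Λ
  | 0, _ => neg bot
  | j + 1, x => conj
      ((List.finRange n).map (fun i => if f x i then var i else neg (var i)) ++
        (D.finite_edges.toFinset.toList.filter fun e => e.2.1 = x).map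
          fun e => dia e.1 (unravel f j e.2.2))

/-- The `n`-th modal approximation of `e`, with `n` variables and of modal depth less than `n`. -/
noncomputable def approx (n : ℕ) : ModalFormula Λ :=
  disj ((Set.finite_univ (α := D.W → Fin n → Prop)).toFinset.toList.map
    fun f => D.unravel f n D.root)

variable {D} {F : KripkeFrame Λ} {θ : ℕ → Set F.W}

theorem sat_unravel_zero {n : ℕ} (f : D.W → Fin n → Prop) (x : D.W) (u : F.W) :
    F.Sat θ u (D.unravel f 0 x) :=
  id

theorem sat_unravel_succ {n : ℕ} (f : D.W → Fin n → Prop) (j : ℕ) (x : D.W) (u : F.W) :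
    F.Sat θ u (D.unravel f (j + 1) x) ↔ F.colour θ n u = f x ∧
      ∀ a y, D.R a x y → ∃ u', F.R a u u' ∧ F.Sat θ u' (D.unravel f j y) := by
  rw [unravel, F.sat_conj, List.forall_mem_append, List.forall_mem_map, List.forall_mem_map]
  simp only [List.mem_filter, Finset.mem_toList, Set.Finite.mem_toFinset, Set.mem_ofPred_eq,
    decide_eq_true_eq, Prod.forall, List.mem_finRange, true_implies, and_imp]
  refine and_congr ?_ ⟨fun h a y hxy => h a x y hxy rfl, ?_⟩
  · rw [funext_iff]
    refine forall_congr' fun i => ?_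
    split_ifs with hi
    · simp [KripkeFrame.colour, KripkeFrame.Sat, hi]
    · simp [KripkeFrame.colour, KripkeFrame.Sat, KripkeFrame.sat_neg, hi]
  · rintro h a _ y hxy rfl
    exact h a y hxy

theorem sat_approx {n : ℕ} {w : F.W} :
    F.Sat θ w (D.approx n) ↔ ∃ f, F.Sat θ w (D.unravel (n := n) f n D.root) := by
  rw [approx, F.sat_disj]
  simp

/-- The approximations hold at a point from which the unravelling of `D` can be followed. -/
theorem sat_approx_of_simulation {n : ℕ} {w : F.W} (f : D.W → Fin n → Prop)
    (Z : D.W → F.W → Prop) (hw : Z D.root w) (hZ : ∀ x u, Z x u → F.colour θ n u = f x ∧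
      ∀ a y, D.R a x y → ∃ u', F.R a u u' ∧ Z y u') : F.Sat θ w (D.approx n) := by
  refine sat_approx.2 ⟨f, ?_⟩
  have h : ∀ j x u, Z x u → F.Sat θ u (D.unravel f j x) := by
    intro j
    induction j with
    | zero => exact fun x u _ => sat_unravel_zero f x u
    | succ j ih =>
      intro x u hu
      refine (sat_unravel_succ f j x u).2 ⟨(hZ x u hu).1, fun a y hxy => ?_⟩
      obtain ⟨u', h1, h2⟩ := (hZ x u hu).2 a y hxy
      exact ⟨u', h1, ih y u' h2⟩
  exact h n _ _ hw

theorem HomAt.sat_approx {w : F.W} {h : D.W → F.W} (hh : D.HomAt F.R w h) (n : ℕ) :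
    F.Sat θ w (D.approx n) :=
  sat_approx_of_simulation (fun x => F.colour θ n (h x)) (fun x u => h x = u) hh.1 (by
    rintro x _ rfl
    exact ⟨rfl, fun a y hxy => ⟨h y, hh.2 a x y hxy, rfl⟩⟩)

theorem approx_mem_Log (n : ℕ) : D.approx n ∈ Log D.frameClass := fun F hF θ w => by
  obtain ⟨h, hh⟩ := D.mem_frameClass.1 hF w
  exact hh.sat_approx n

/-- Approximations with sufficiently many variables yield maps that preserve the edges up to
colours. -/
theorem IsRooted.exists_map_of_sat_approx (hD : D.IsRooted) : ∃ B : ℕ, ∀ n ≥ B,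
    ∀ (F : KripkeFrame Λ) (θ : ℕ → Set F.W) (w : F.W), F.Sat θ w (D.approx n) →
      ∃ u : D.W → F.W, u D.root = w ∧ ∀ a x y, D.R a x y →
        ∃ u', F.R a (u x) u' ∧ F.colour θ n u' = F.colour θ n (u y) := by
  classical
  have h : ∀ x, ∃ m : ℕ, ∀ (F : KripkeFrame Λ) (θ : ℕ → Set F.W) (w : F.W) (n : ℕ)
      (f : D.W → Fin n → Prop) (j : ℕ), F.Sat θ w (D.unravel f (j + m) D.root) →
        ∃ u, F.Sat θ u (D.unravel f j x) := by
    intro x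
    induction hD x with
    | refl => exact ⟨0, fun F θ w n f j h => ⟨w, h⟩⟩
    | tail _ h ih =>
      obtain ⟨m, hm⟩ := ih
      obtain ⟨a, ha⟩ := h
      refine ⟨m + 1, fun F θ w n f j h => ?_⟩
      obtain ⟨u, hu⟩ := hm F θ w n f (j + 1) (by rwa [show j + 1 + m = j + (m + 1) by omega])
      obtain ⟨u', -, hu'⟩ := ((sat_unravel_succ f j _ u).1 hu).2 a _ ha
      exact ⟨u', hu'⟩
  choose m hm using h
  obtain ⟨B, hB⟩ := (Set.finite_range m).bddAbove
  refine ⟨B + 2, fun n hn F θ w hw => ?_⟩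
  obtain ⟨f, hf⟩ := FinPointedFrame.sat_approx.1 hw
  -- Two levels must remain at each point: one for its own colour, one for the colours of its
  -- successors. The root is pinned to `w`.
  have h1 : ∀ x, ∃ u : F.W, (x = D.root → u = w) ∧ ∃ j, F.Sat θ u (D.unravel f (j + 2) x) := by
    intro x
    by_cases hx : x = D.root
    · subst hx
      exact ⟨w, fun _ => rfl, n - 2, by rwa [Nat.sub_add_cancel (by omega)]⟩
    · have hmB : m x ≤ B := hB ⟨x, rfl⟩
      obtain ⟨u, hu⟩ := hm x F θ w n f (n - m x) (by rwa [Nat.sub_add_cancel (by omega)])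
      exact ⟨u, fun h => absurd h hx, n - m x - 2, by rwa [Nat.sub_add_cancel (by omega)]⟩
  choose u hu j hj using h1
  refine ⟨u, hu _ rfl, fun a x y hxy => ?_⟩
  obtain ⟨u', h1, h2⟩ := ((sat_unravel_succ f _ x _).1 (hj x)).2 a y hxy
  exact ⟨u', h1, ((sat_unravel_succ f _ y _).1 h2).1.trans
    ((sat_unravel_succ f _ y _).1 (hj y)).1.symm⟩

/-! ### Canonicity of the logic and its axiomatisation -/

/-- The approximations axiomatise a logic whose canonical frame satisfies `∀ x₀ e(x₀)`. -/
theorem IsRooted.canonicalFrame_mem (hD : D.IsRooted) {L : Set (ModalFormula Λ)}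
    (hL : IsNormalLogic L) (h : ∀ n, D.approx n ∈ L) : canonicalFrame L ∈ D.frameClass := by
  classical
  rw [mem_frameClass]
  intro w
  obtain ⟨B, hB⟩ := hD.exists_map_of_sat_approx
  -- Substituting the members of `Φ` for the variables, with `bot` as padding, makes points of equal
  -- colour agree on `Φ`.
  have key : ∀ Φ : Finset (ModalFormula Λ), ∃ u : D.W → (canonicalFrame L).W, u D.root = w ∧
      ∀ a x y, D.R a x y → ∀ φ ∈ Φ, φ ∈ (u y).1 → dia a φ ∈ (u x).1 := by
    intro Φ
    obtain ⟨u, hu0, hu⟩ := hB (max B Φ.toList.length) (le_max_left _ _) (canonicalFrame L)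
      (fun p => {Θ | Φ.toList.getD p bot ∈ Θ.1}) w
      ((hL.sat_canonicalFrame (fun p => Φ.toList.getD p bot) _ w).2
        (((hL.maximal_iff _).1 w.2).1 (hL.subst _ _ (h _))))
    refine ⟨u, hu0, fun a x y hxy φ hφ hy => ?_⟩
    obtain ⟨u', hR, hc⟩ := hu a x y hxy
    obtain ⟨i, hi, hget⟩ := List.mem_iff_getElem.1 (Finset.mem_toList.2 hφ)
    have hi' := congrFun hc ⟨i, hi.trans_le (le_max_right _ _)⟩
    simp only [KripkeFrame.colour, Set.mem_ofPred_eq, List.getD_eq_getElem _ _ hi, hget] at hi'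
    exact hR φ (hi'.mpr hy)
  choose u hu0 hu using key
  -- Refining `atTop` makes every formula eventually belong to `Φ`; ultrafilter limits of maximal
  -- consistent sets are again maximal consistent.
  let 𝒰 : Ultrafilter (Finset (ModalFormula Λ)) := Ultrafilter.of Filter.atTop
  have h𝒰 : ∀ φ : ModalFormula Λ, ∀ᶠ Φ in (𝒰 : Filter (Finset (ModalFormula Λ))), φ ∈ Φ := by
    intro φ
    refine Ultrafilter.of_le Filter.atTop ?_
    filter_upwards [Filter.eventually_ge_atTop {φ}] with Φ hΦ
    exact hΦ (Finset.mem_singleton_self φ)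
  have hmcs : ∀ x Φ, L ⊆ (u Φ x).1 ∧ IsBoolean (· ∈ (u Φ x).1) :=
    fun x Φ => (hL.maximal_iff _).1 (u Φ x).2
  let Θ : D.W → Set (ModalFormula Λ) := fun x =>
    {φ | ∀ᶠ Φ in (𝒰 : Filter (Finset (ModalFormula Λ))), φ ∈ (u Φ x).1}
  have hΘ : ∀ x, Maximal (Consistent L) (Θ x) := by
    intro x
    refine (hL.maximal_iff _).2 ⟨fun φ hφ => Filter.Eventually.of_forall fun Φ =>
      (hmcs x Φ).1 hφ, fun hb => ?_, fun φ ψ => ?_⟩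
    · obtain ⟨Φ, hΦ⟩ := hb.exists
      exact (hmcs x Φ).2.1 hΦ
    · simp only [Θ, Set.mem_ofPred_eq]
      rw [← Ultrafilter.eventually_imp]
      exact Filter.eventually_congr (Filter.Eventually.of_forall fun Φ => (hmcs x Φ).2.2 φ ψ)
  refine ⟨fun x => ⟨Θ x, hΘ x⟩, Subtype.ext ?_, fun a x y hxy φ hφ => ?_⟩
  · ext φ
    simp [Θ, hu0]
  · change ∀ᶠ Φ in (𝒰 : Filter (Finset (ModalFormula Λ))), dia a φ ∈ (u Φ x).1
    filter_upwards [h𝒰 φ, (hφ : ∀ᶠ Φ in (𝒰 : Filter (Finset (ModalFormula Λ))), φ ∈ (u Φ y).1)]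
      with Φ h1 h2
    exact hu Φ a x y hxy φ h1 h2

theorem IsRooted.isCanonicalLogic (hD : D.IsRooted) : IsCanonicalLogic (Log D.frameClass) :=
  fun _ hφ => hφ _ (hD.canonicalFrame_mem (isNormalLogic_Log _) approx_mem_Log)

/-- The canonical frame of the logic of all approximations satisfies `∀ x₀ e(x₀)`, so it validates
every formula of `Log`; validity there implies membership. -/
theorem IsRooted.Log_subset (hD : D.IsRooted) :
    Log D.frameClass ⊆ KPlus (Set.range D.approx) := fun _ hφ =>
  (isNormalLogic_KPlus _).mem_of_valid (hφ _ (hD.canonicalFrame_mem (isNormalLogic_KPlus _)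
    fun n => subset_KPlus _ ⟨n, rfl⟩))

/-- Finitely many formulas of the logic follow from finitely many approximations. -/
theorem IsRooted.exists_subset_KPlus (hD : D.IsRooted) {Γ : Set (ModalFormula Λ)}
    (hfin : Γ.Finite) (hΓ : Γ ⊆ Log D.frameClass) :
    ∃ n, Γ ⊆ KPlus (D.approx '' Set.Iic n) := by
  have h1 : ∀ φ ∈ Γ, ∃ n, φ ∈ KPlus (D.approx '' Set.Iic n) := by
    intro φ hφ
    obtain ⟨Γ₀, hsub, hf, hm⟩ := exists_finite_of_mem_KPlus (hD.Log_subset (hΓ hφ))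
    choose! i hi using fun ψ (hψ : ψ ∈ Γ₀) => hsub hψ
    obtain ⟨n, hn⟩ := (hf.image i).bddAbove
    have hsub' : Γ₀ ⊆ D.approx '' Set.Iic n := fun ψ hψ =>
      ⟨i ψ, hn (Set.mem_image_of_mem i hψ), hi ψ hψ⟩
    exact ⟨n, KPlus_mono hsub' hm⟩
  choose! n hn using h1
  obtain ⟨N, hN⟩ := (hfin.image n).bddAbove
  exact ⟨N, fun φ hφ => KPlus_mono
    (Set.image_mono (Set.Iic_subset_Iic.2 (hN ⟨φ, hφ, rfl⟩))) (hn φ hφ)⟩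

end FinPointedFrame

end ModalDiagram

namespace ModalDiagram

open ModalFormula

variable {Λ : Type u}

/-! ### Canonical formulas on descriptive frames -/

/-- A canonical formula that is valid in a countable descriptive general frame, presented as a
compact zero-dimensional space, is valid in the underlying Kripke frame. -/
theorem IsCanonicalFormula.valid_of_clopen {φ : ModalFormula Λ} (hφ : IsCanonicalFormula φ)
    {F : KripkeFrame Λ} [TopologicalSpace F.W] [CompactSpace F.W] [T2Space F.W]
    [TotallyDisconnectedSpace F.W] [SecondCountableTopology F.W]
    (hclosed : ∀ a x, IsClosed {y | F.R a x y})
    (hA : IsModalAlgebra F {U | IsClopen U}) (h : φ ∈ generalLog F {U | IsClopen U}) :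
    F.Valid φ := by
  have : Countable (TopologicalSpace.Clopens F.W) :=
    TopologicalSpace.Clopens.countable_iff_secondCountable.2 inferInstance
  obtain ⟨e, he⟩ := exists_surjective_nat (TopologicalSpace.Clopens F.W)
  let θ : ℕ → Set F.W := fun p => e p
  have hθ : ∀ p, θ p ∈ {U : Set F.W | IsClopen U} := fun p => (e p).isClopen
  have hsep : ∀ {s : Set F.W} {y : F.W}, IsClosed s → y ∉ s →
      ∃ p, y ∈ θ p ∧ Disjoint (θ p) s := by
    intro s y hs hy
    obtain ⟨U, hU, hyU, hUs⟩ := compact_exists_isClopen_in_isOpen hs.isOpen_compl hy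
    obtain ⟨p, hp⟩ := he ⟨U, hU⟩
    have hpU : θ p = U := congrArg TopologicalSpace.Clopens.carrier hp
    exact ⟨p, hpU ▸ hyU, Set.disjoint_left.2 fun z hz => hUs (hpU ▸ hz)⟩
  set L := KPlus {φ}
  have hL : IsNormalLogic L := isNormalLogic_KPlus _
  have hLF : L ⊆ generalLog F {U | IsClopen U} :=
    KPlus_subset hA.isNormalLogic (by simpa using h)
  -- Since the variables name all clopen sets, `T` will be an isomorphism onto a generated subframe
  -- of the canonical frame.
  let T : F.W → (canonicalFrame L).W := fun x => ⟨{ψ | F.Sat θ x ψ},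
    (hL.maximal_iff _).2 ⟨fun ψ hψ => hLF hψ θ hθ x, F.isBoolean_sat θ x⟩⟩
  have hT : ∀ x ψ, ψ ∈ (T x).1 ↔ F.Sat θ x ψ := fun _ _ => Iff.rfl
  have hinj : Function.Injective T := by
    intro x y hxy
    by_contra hne
    obtain ⟨p, h1, h2⟩ := hsep isClosed_singleton (Ne.symm hne : y ∉ ({x} : Set F.W))
    have : var p ∈ (T x).1 := hxy ▸ (hT y (var p)).2 h1
    exact Set.disjoint_left.1 h2 this rfl
  have hforth : ∀ a x y, F.R a x y → (canonicalFrame L).R a (T x) (T y) :=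
    fun a x y hxy ψ hψ => ⟨y, hxy, hψ⟩
  have hback : ∀ a x Δ, (canonicalFrame L).R a (T x) Δ → ∃ y, F.R a x y ∧ T y = Δ := by
    intro a x Δ hR
    obtain ⟨-, hΔ⟩ := (hL.maximal_iff _).1 Δ.2
    -- Any finite part of `Δ` is true at a successor of `x`; compactness gives one point for all of
    -- `Δ`.
    obtain ⟨y, hy⟩ : (⋂ ψ : Δ.1, {y | F.Sat θ y ψ.1}).Nonempty := by
      refine CompactSpace.iInter_nonempty (fun ψ => (hA.sat_mem hθ ψ.1).1) fun s => ?_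
      have hs : neg ((s.toList.map Subtype.val).foldr imp bot) ∈ Δ.1 := by
        rw [hΔ.neg, hΔ.foldr]
        intro hc
        refine hΔ.1 (hc ?_)
        simp only [List.mem_map]
        rintro _ ⟨ψ, -, rfl⟩
        exact ψ.2
      obtain ⟨y, -, hy⟩ := hR _ hs
      rw [F.sat_neg, (F.isBoolean_sat θ y).foldr] at hy
      refine ⟨y, Set.mem_iInter₂.2 fun ψ hψ => ?_⟩
      by_contra hn
      exact hy fun hc => absurd (hc ψ.1 (List.mem_map.2 ⟨ψ, Finset.mem_toList.2 hψ, rfl⟩)) hn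
    have hyΔ : ∀ ψ, ψ ∈ Δ.1 → F.Sat θ y ψ := fun ψ hψ => Set.mem_iInter.1 hy ⟨ψ, hψ⟩
    have hTy : T y = Δ := by
      refine Subtype.ext (Set.Subset.antisymm (fun ψ hψ => ?_) hyΔ)
      by_contra hn
      exact hyΔ _ ((hΔ.neg ψ).2 hn) hψ
    refine ⟨y, ?_, hTy⟩
    -- Otherwise a clopen set separates `y` from the closed set of successors of `x`, and the
    -- variable naming it contradicts `hR`.
    by_contra hn
    obtain ⟨p, h1, h2⟩ := hsep (hclosed a x) hn
    obtain ⟨z, hz1, hz2⟩ := hR (var p) (hTy ▸ (hT y (var p)).2 h1)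
    exact Set.disjoint_left.1 h2 hz2 hz1
  intro η x
  -- The valuation `η` is arbitrary, not clopen: it is transported to the canonical frame by taking
  -- images.
  have htruth : ∀ ψ x, (canonicalFrame L).Sat (fun p => T '' η p) (T x) ψ ↔ F.Sat η x ψ := by
    intro ψ
    induction ψ with
    | var p => exact fun x => hinj.mem_set_image
    | bot => exact fun x => Iff.rfl
    | imp ψ χ h1 h2 => exact fun x => imp_congr (h1 x) (h2 x)
    | dia a ψ ih =>
      intro x
      constructor
      · rintro ⟨Δ, hR, hs⟩
        obtain ⟨y, hy, rfl⟩ := hback a x Δ hR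
        exact ⟨y, hy, (ih y).1 hs⟩
      · rintro ⟨y, hy, hs⟩
        exact ⟨T y, hforth a x y hy, (ih y).2 hs⟩
  exact (htruth φ x).1 (hφ _ _)

end ModalDiagram

namespace ModalDiagram

/-! ### A forest on a Cantor space without small clopen colourings -/

namespace CantorForest

/-- The number of strings of length `n`. -/
def numStrings (M : ℕ) : ℕ → ℕ
  | 0 => 1
  | n + 1 => numStrings M n * (M ^ numStrings M n + 2)

/-- The points: sequences whose `n`-th entry is taken from a set larger than the number of
`M`-colourings of the strings of length `n`. -/
abbrev Point (M : ℕ) : Type := ∀ n : ℕ, Fin (M ^ numStrings M n + 2)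

variable {M : ℕ}

/-- The string of the first `k` entries. -/
def initial (k : ℕ) (x : Point M) : List ℕ := (List.range k).map fun i => (x i : ℕ)

/-- The `n`-th entries of `x` and `y` are to be different if initial strings of `x` and `y` form
the pair of strings coded by `n`. -/
def Flip (n : ℕ) (x y : Point M) : Prop :=
  Encodable.encode (initial n.unpair.1 x, initial n.unpair.1 y) = n.unpair.2 ∨
    Encodable.encode (initial n.unpair.1 y, initial n.unpair.1 x) = n.unpair.2

/-- The adjacency relation, restricted to the first `N` entries. -/
def AdjBelow (N : ℕ) (x y : Point M) : Prop := ∀ n < N, x n ≠ y n ↔ Flip n x y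

theorem initial_congr {k : ℕ} {x y : Point M} (h : ∀ i < k, x i = y i) :
    initial k x = initial k y :=
  List.map_congr_left fun i hi => by rw [h i (List.mem_range.1 hi)]

theorem eq_of_initial_eq {k : ℕ} {x y : Point M} (h : initial k x = initial k y) {i : ℕ}
    (hi : i < k) : x i = y i :=
  Fin.ext (List.map_inj_left.1 h i (List.mem_range.2 hi))

/-- The coded string length is at most `n`, so whether entry `n` flips is decided by earlier
entries. This permits entrywise constructions. -/
theorem flip_congr {n : ℕ} {x y x' y' : Point M} (hx : ∀ i < n, x i = x' i)
    (hy : ∀ i < n, y i = y' i) : Flip n x y ↔ Flip n x' y' := by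
  have hn : n.unpair.1 ≤ n := Nat.unpair_left_le n
  rw [Flip, Flip, initial_congr fun i hi => hx i (hi.trans_le hn),
    initial_congr fun i hi => hy i (hi.trans_le hn)]

theorem flip_comm {n : ℕ} {x y : Point M} : Flip n x y ↔ Flip n y x := or_comm

theorem AdjBelow.congr {N : ℕ} {x y x' y' : Point M} (h : AdjBelow N x y)
    (hx : ∀ i < N, x i = x' i) (hy : ∀ i < N, y i = y' i) : AdjBelow N x' y' := fun n hn => by
  rw [← hx n hn, ← hy n hn, h n hn]
  exact flip_congr (fun i hi => hx i (hi.trans hn)) (fun i hi => hy i (hi.trans hn))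

theorem ne_of_adj {x y : Point M} (h : ∀ N, AdjBelow N x y) : x ≠ y := by
  rintro rfl
  -- The entry coding the pair of empty strings flips for every pair of points.
  let n := Nat.pair 0 (Encodable.encode (([] : List ℕ), ([] : List ℕ)))
  refine (h (n + 1) n n.lt_succ_self).2 (Or.inl ?_) rfl
  simp [n, initial]

/-- Adjacency. -/
def graph (M : ℕ) : SimpleGraph (Point M) where
  Adj x y := ∀ N, AdjBelow N x y
  symm := ⟨fun x y h N n hn => by rw [ne_comm, flip_comm, h N n hn]⟩
  loopless := ⟨fun _ h => ne_of_adj h rfl⟩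

/-- Entries of `y'` from `N` on are chosen recursively: copy the entry of `x`, or take a different
value when a flip is due. The summand 2 in the entry ranges ensures a second value. -/
theorem exists_lift (N : ℕ) {x y : Point M} (h : AdjBelow N x y) :
    ∃ y', (∀ i < N, y i = y' i) ∧ (graph M).Adj x y' := by
  classical
  have ho : ∀ n, ∃ b, b ≠ x n := fun n => exists_ne _
  choose o ho using ho
  obtain ⟨z, hz0, hz⟩ : ∃ z : ℕ → Point M, z 0 = y ∧ ∀ n, z (n + 1) = if n < N then z n else
      Function.update (z n) n (if Flip n x (z n) then o n else x n) :=
    ⟨Nat.rec y fun n z => if n < N then z else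
      Function.update z n (if Flip n x z then o n else x n), rfl, fun _ => rfl⟩
  have hstep : ∀ n i, i ≠ n → z (n + 1) i = z n i := by
    intro n i hi
    rw [hz]
    split_ifs <;> simp [hi]
  have hstable : ∀ i m, i + 1 ≤ m → z m i = z (i + 1) i := by
    intro i m hm
    induction m, hm using Nat.le_induction with
    | base => rfl
    | succ m hm ih => rw [hstep m i (by omega), ih]
  have hlow : ∀ i < N, ∀ m, z m i = y i := by
    intro i hi m
    induction m with
    | zero => rw [hz0]
    | succ m ih =>
      by_cases e : i = m
      · rw [hz, if_pos (e ▸ hi), ih]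
      · rw [hstep m i e, ih]
  refine ⟨fun i => z (i + 1) i, fun i hi => (hlow i hi (i + 1)).symm, fun K n _ => ?_⟩
  change x n ≠ z (n + 1) n ↔ Flip n x fun i => z (i + 1) i
  by_cases hn : n < N
  · rw [hlow n hn, h n hn]
    exact flip_congr (fun _ _ => rfl) fun i hi => (hlow i (hi.trans hn) (i + 1)).symm
  · have hf : Flip n x (fun i => z (i + 1) i) ↔ Flip n x (z n) :=
      flip_congr (fun _ _ => rfl) fun i hi => (hstable i n hi).symm
    rw [hf, hz, if_neg hn, Function.update_self]
    split_ifs with hF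
    · simpa [hF] using (ho n).symm
    · simp [hF]

theorem numStrings_eq_prod (N : ℕ) :
    numStrings M N = ∏ k : Fin N, (M ^ numStrings M k + 2) := by
  induction N with
  | zero => rfl
  | succ N ih =>
    simp only [numStrings, Fin.prod_univ_castSucc, Fin.val_castSucc, Fin.val_last, ← ih]

/-- A colouring with `M` colours that depends on `N` entries is not proper for `AdjBelow N`. -/
theorem exists_monochromatic {C : Type*} [Finite C] (hC : Nat.card C ≤ M) (N : ℕ)
    (c : Point M → C) (hc : ∀ x y : Point M, (∀ i < N, x i = y i) → c x = c y) :
    ∃ x y, AdjBelow N x y ∧ c x = c y := by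
  classical
  have := Fintype.ofFinite C
  rw [Nat.card_eq_fintype_card] at hC
  induction N generalizing c with
  | zero => exact ⟨0, 0, fun n hn => absurd hn n.not_lt_zero, rfl⟩
  | succ N ih =>
    let ext (s : ∀ k : Fin N, Fin (M ^ numStrings M k + 2)) : Point M :=
      fun k => if h : k < N then s ⟨k, h⟩ else 0
    -- Each value of entry `N` induces an `M`-colouring of strings of length `N`. There are more
    -- values than such colourings, so distinct `i` and `j` induce the same one, and either flip
    -- requirement can be met without changing colours.
    obtain ⟨i, j, hij, hp⟩ := Fintype.exists_ne_map_eq_of_card_lt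
      (fun (i : Fin (M ^ numStrings M N + 2)) s => c (Function.update (ext s) N i)) (by
        rw [Fintype.card_fun, Fintype.card_pi, Fintype.card_fin]
        simp only [Fintype.card_fin]
        rw [← numStrings_eq_prod]
        exact (Nat.pow_le_pow_left hC _).trans_lt (by omega))
    have hp' : ∀ x : Point M, c (Function.update x N i) = c (Function.update x N j) := by
      intro x
      have hx : ∀ b, c (Function.update x N b) =
          c (Function.update (ext fun k => x k) N b) := by
        refine fun b => hc _ _ fun k hk => ?_
        rcases Nat.lt_succ_iff_lt_or_eq.1 hk with h | rfl
        · simp [h.ne, ext, h]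
        · simp
      rw [hx, hx]
      exact congrFun hp fun k => x k
    obtain ⟨x, y, hxy, hcxy⟩ := ih (fun x => c (Function.update x N i)) fun x y h =>
      hc _ _ fun k hk => by
        rcases Nat.lt_succ_iff_lt_or_eq.1 hk with h' | rfl
        · simp [h'.ne, h k h']
        · simp
    have hu : ∀ (z : Point M) b, ∀ k < N, z k = Function.update z N b k := fun z b k hk => by
      simp [hk.ne]
    have key : ∀ b b', (b ≠ b' ↔ Flip N x y) →
        AdjBelow (N + 1) (Function.update x N b) (Function.update y N b') := by
      intro b b' hb n hn
      rcases Nat.lt_succ_iff_lt_or_eq.1 hn with h | rfl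
      · exact hxy.congr (hu x b) (hu y b') n h
      · simpa only [Function.update_self, hb] using flip_congr (hu x b) (hu y b')
    by_cases hF : Flip N x y
    · exact ⟨_, _, key i j (iff_of_true hij hF), hcxy.trans (hp' y)⟩
    · exact ⟨_, _, key i i (iff_of_false (not_not.2 rfl) hF), hcxy⟩

theorem isClopen_of_determined (N : ℕ) {U : Set (Point M)}
    (hU : ∀ x y : Point M, (∀ i < N, x i = y i) → x ∈ U → y ∈ U) : IsClopen U := by
  let π : Point M → ∀ k : Fin N, Fin (M ^ numStrings M k + 2) := fun x k => x k
  have hπ : Continuous π := continuous_pi fun k => continuous_apply _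
  have h : U = π ⁻¹' (π '' U) := by
    refine (Set.subset_preimage_image _ _).antisymm ?_
    rintro y ⟨x, hx, hxy⟩
    exact hU x y (fun i hi => congrFun hxy ⟨i, hi⟩) hx
  rw [h]
  exact (isClopen_discrete _).preimage hπ

/-- A partition into clopen sets depends on finitely many entries. -/
theorem exists_determined {C : Type*} (c : Point M → C) (hc : ∀ s, IsOpen (c ⁻¹' {s})) :
    ∃ N, ∀ x y : Point M, (∀ i < N, x i = y i) → c x = c y := by
  have h1 : ∀ x : Point M, ∃ N, ∀ y, (∀ i < N, x i = y i) → c y = c x := by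
    intro x
    obtain ⟨I, W, hW, hsub⟩ := isOpen_pi_iff.1 (hc (c x)) x rfl
    refine ⟨I.sup id + 1, fun y hy => hsub fun i hi => ?_⟩
    rw [← hy i (Nat.lt_succ_of_le (Finset.le_sup (f := id) hi))]
    exact (hW i hi).2
  choose N hN using h1
  obtain ⟨t, -, ht⟩ := isCompact_univ.elim_nhds_subcover
    (fun x => {y : Point M | ∀ i < N x, x i = y i}) fun x _ =>
      (isClopen_of_determined (N x) fun y z h hy i hi => (hy i hi).trans (h i hi)).isOpen.mem_nhds
        fun _ _ => rfl
  refine ⟨t.sup N, fun x y hxy => ?_⟩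
  obtain ⟨z, hz, hx⟩ := Set.mem_iUnion₂.1 (ht (Set.mem_univ x))
  rw [hN z x hx, hN z y fun i hi =>
    (hx i hi).trans (hxy i (hi.trans_le (Finset.le_sup (f := N) hz)))]

theorem isClosed_neighbours (x : Point M) : IsClosed {y | (graph M).Adj x y} := by
  have : {y | (graph M).Adj x y} = ⋂ N, {y | AdjBelow N x y} := by
    ext y
    simp [graph]
  rw [this]
  exact isClosed_iInter fun N =>
    (isClopen_of_determined N fun y z h hy => hy.congr (fun _ _ => rfl) h).isClosed

/-- If `U` depends on `N` entries, so does its set of neighbours, by lifting finite adjacencies. -/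
theorem isClopen_preimage {U : Set (Point M)} (hU : IsClopen U) :
    IsClopen {x | ∃ y, (graph M).Adj x y ∧ y ∈ U} := by
  obtain ⟨N, hN⟩ := exists_determined (fun x => x ∈ U) fun s => by
    by_cases hs : s
    · convert hU.isOpen using 1
      ext; simp [hs]
    · convert hU.compl.isOpen using 1
      ext; simp [hs]
  refine isClopen_of_determined N ?_
  rintro x x' h ⟨y, hxy, hy⟩
  obtain ⟨y', h1, h2⟩ := exists_lift N ((hxy N).congr h fun _ _ => rfl)
  exact ⟨y', h2, (hN y y' h1).mp hy⟩

theorem exists_adj_monochromatic {C : Type*} [Finite C] (hC : Nat.card C ≤ M)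
    (c : Point M → C) (hc : ∀ s, IsOpen (c ⁻¹' {s})) :
    ∃ x y, (graph M).Adj x y ∧ c x = c y := by
  obtain ⟨N, hN⟩ := exists_determined c hc
  obtain ⟨x, y, hxy, h⟩ := exists_monochromatic hC N c hN
  obtain ⟨y', h1, h2⟩ := exists_lift N hxy
  exact ⟨x, y', h2, h.trans (hN y y' h1)⟩

theorem exists_initial_injOn (s : Finset (Point M)) :
    ∃ k, Set.InjOn (initial k) (s : Set (Point M)) := by
  classical
  have h : ∀ p : Point M × Point M, ∃ i, p.1 ≠ p.2 → p.1 i ≠ p.2 i := by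
    intro p
    by_cases e : p.1 = p.2
    · exact ⟨0, fun h => absurd e h⟩
    · obtain ⟨i, hi⟩ := Function.ne_iff.1 e
      exact ⟨i, fun _ => hi⟩
  choose d hd using h
  refine ⟨(s ×ˢ s).sup d + 1, fun x hx y hy hxy => ?_⟩
  by_contra hne
  exact hd (x, y) hne (eq_of_initial_eq hxy
    (Nat.lt_succ_of_le (Finset.le_sup (f := d) (Finset.mk_mem_product hx hy))))

/-- Some entry distinguishes `u` from `v` but flips along no other edge of a given finite walk, so a
walk from `u` to `v` cannot avoid the edge `uv`. -/
theorem isAcyclic_graph : (graph M).IsAcyclic := by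
  classical
  rw [SimpleGraph.isAcyclic_iff_forall_adj_isBridge]
  intro u v huv
  rw [SimpleGraph.isBridge_iff_forall_walk_mem_edges]
  intro p
  by_contra hp
  -- Strings of length `k` identify the vertices of the walk, so the entry `n` coding the strings of
  -- `u` and `v` flips only along this edge.
  obtain ⟨k, hk⟩ := exists_initial_injOn p.support.toFinset
  simp only [List.coe_toFinset] at hk
  let n := Nat.pair k (Encodable.encode (initial k u, initial k v))
  have hn : ∀ x y : Point M, Flip n x y ↔ initial k x = initial k u ∧ initial k y = initial k v ∨
      initial k y = initial k u ∧ initial k x = initial k v := by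
    intro x y
    simp [Flip, n]
  have hne : u n ≠ v n := (huv (n + 1) n n.lt_succ_self).2 ((hn u v).2 (Or.inl ⟨rfl, rfl⟩))
  refine hne ?_
  have hstep : ∀ x ∈ p.support, ∀ y ∈ p.support, (graph M).Adj x y → s(x, y) ≠ s(u, v) →
      x n = y n := by
    intro x hx y hy hxy he
    by_contra h
    have hu := p.start_mem_support
    have hv := p.end_mem_support
    rcases (hn x y).1 ((hxy (n + 1) n n.lt_succ_self).1 h) with ⟨h1, h2⟩ | ⟨h1, h2⟩
    · exact he (by rw [hk hx hu h1, hk hy hv h2])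
    · exact he (by rw [hk hx hv h2, hk hy hu h1, Sym2.eq_swap])
  have hwalk : ∀ {x y : Point M} (q : (graph M).Walk x y), q.support ⊆ p.support →
      q.edges ⊆ p.edges → x n = y n := by
    intro x y q
    induction q with
    | nil => exact fun _ _ => rfl
    | @cons x y z hxy q ih =>
      intro h1 h2
      simp only [SimpleGraph.Walk.support_cons, SimpleGraph.Walk.edges_cons,
        List.cons_subset] at h1 h2
      rw [hstep x h1.1 y (h1.2 q.start_mem_support) hxy fun he => hp (he ▸ h2.1), ih h1.2 h2.2]
  exact hwalk p (fun _ h => h) fun _ h => h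

end CantorForest

/-! ### Graphs separating full from clopen colourings -/

/-- Graphs on compact zero-dimensional spaces that have no proper colouring with `K` colours, and
no clopen one with `M` colours, but a proper colouring with `K + 2` colours. -/
theorem exists_graph (K M : ℕ) : ∃ (V : Type) (_ : TopologicalSpace V) (G : SimpleGraph V),
    CompactSpace V ∧ T2Space V ∧ TotallyDisconnectedSpace V ∧ SecondCountableTopology V ∧
    (∀ x, IsClosed {y | G.Adj x y}) ∧
    (∀ U, IsClopen U → IsClopen {x | ∃ y, G.Adj x y ∧ y ∈ U}) ∧
    G.Colorable (K + 2) ∧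
    (∀ (C : Type u) [Finite C] (c : V → C), Nat.card C ≤ K → ∃ x y, G.Adj x y ∧ c x = c y) ∧
    (∀ (C : Type u) [Finite C] (c : V → C), Nat.card C ≤ M → (∀ s, IsOpen (c ⁻¹' {s})) →
      ∃ x y, G.Adj x y ∧ c x = c y) := by
  classical
  -- The forest excludes clopen colourings but is 2-colourable; the disjoint complete graph excludes
  -- `K` colours.
  refine ⟨CantorForest.Point M ⊕ Fin (K + 2), inferInstance,
    (CantorForest.graph M) ⊕g (⊤ : SimpleGraph (Fin (K + 2))), inferInstance, inferInstance,
    inferInstance, inferInstance, ?_, ?_, ?_, ?_, ?_⟩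
  · rintro (x | x)
    · refine isClosed_sum_iff.2 ⟨?_, ?_⟩
      · exact CantorForest.isClosed_neighbours x
      · exact isClosed_discrete _
    · refine isClosed_sum_iff.2 ⟨?_, isClosed_discrete _⟩
      convert isClosed_empty using 1
      ext; simp
  · intro U hU
    have h1 : IsClopen (Sum.inl ⁻¹' U : Set (CantorForest.Point M)) :=
      hU.preimage continuous_inl
    have h2 : (Sum.inl ⁻¹' {x | ∃ y, ((CantorForest.graph M) ⊕g
        (⊤ : SimpleGraph (Fin (K + 2)))).Adj x y ∧ y ∈ U} : Set (CantorForest.Point M)) =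
        {x | ∃ y, (CantorForest.graph M).Adj x y ∧ y ∈ Sum.inl ⁻¹' U} := by
      ext; simp
    have h3 := CantorForest.isClopen_preimage h1
    rw [← h2] at h3
    exact ⟨isClosed_sum_iff.2 ⟨h3.isClosed, isClosed_discrete _⟩,
      isOpen_sum_iff.2 ⟨h3.isOpen, isOpen_discrete _⟩⟩
  · obtain ⟨κ⟩ := (CantorForest.isAcyclic_graph (M := M)).colorable_two.mono
      (Nat.le_add_left 2 K)
    refine ⟨SimpleGraph.Coloring.mk (Sum.elim κ id) ?_⟩
    rintro (x | x) (y | y) h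
    · exact κ.valid h
    · simp at h
    · simp at h
    · simpa using h
  · intro C _ c hC
    have := Fintype.ofFinite C
    rw [Nat.card_eq_fintype_card] at hC
    obtain ⟨i, j, hij, h⟩ := Fintype.exists_ne_map_eq_of_card_lt (fun i => c (Sum.inr i))
      (by rw [Fintype.card_fin]; omega)
    exact ⟨Sum.inr i, Sum.inr j, by simpa using hij, h⟩
  · intro C _ c hC hc
    obtain ⟨x, y, hxy, h⟩ := CantorForest.exists_adj_monochromatic hC (fun x => c (Sum.inl x))
      fun s => (hc s).preimage continuous_inl
    exact ⟨Sum.inl x, Sum.inl y, by simpa using hxy, h⟩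

end ModalDiagram

namespace ModalDiagram

open ModalFormula

variable {Λ : Type u}

namespace FinPointedFrame

variable {D : FinPointedFrame Λ}

/-! ### Edges on inner cycles -/

/-- An inner cycle contains an edge that can be omitted without disconnecting its ends in the
diagram without the root. -/
theorem HasInnerCycle.exists_edge (h : D.HasInnerCycle) : ∃ (c : Λ) (y z : D.NonRoot),
    D.R c y.1 z.1 ∧ ∀ {β : Type u} (g : D.NonRoot → β), (∀ a (x x' : D.NonRoot), D.R a x.1 x'.1 →
      ¬ (a = c ∧ x = y ∧ x' = z) → g x = g x') → g y = g z := by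
  classical
  obtain ⟨h, z, ℓ, hc, hroot⟩ := h
  -- A shortest closed segment repeats no vertex except at its ends.
  have hex : ∃ d, 0 < d ∧ ∃ i, i + d ≤ h ∧ z i = z (i + d) :=
    ⟨h, hc.pos, 0, by omega, by simpa using hc.closed⟩
  obtain ⟨hd, i, hih, hi⟩ := Nat.find_spec hex
  have hmin : ∀ j k, j < k → k ≤ h → k - j < Nat.find hex → z j ≠ z k := by
    intro j k hjk hk hlt he
    exact Nat.find_min hex hlt ⟨by omega, j, by omega, by rwa [Nat.add_sub_cancel' hjk.le]⟩
  generalize Nat.find hex = d at *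
  let e : ℕ → Λ × D.W × D.W := fun k =>
    if (ℓ k).2 then ((ℓ k).1, z k, z (k + 1)) else ((ℓ k).1, z (k + 1), z k)
  have he : ∀ k < h, D.R (e k).1 (e k).2.1 (e k).2.2 := by
    intro k hk
    have hs := hc.step k hk
    rcases hl : ℓ k with ⟨a, b⟩
    cases b <;> simp only [hl, UStep] at hs <;> simpa [e, hl] using hs
  have he' : ∀ k, (e k).2.1 = z k ∧ (e k).2.2 = z (k + 1) ∨
      (e k).2.1 = z (k + 1) ∧ (e k).2.2 = z k := by
    intro k
    rcases hl : (ℓ k).2 <;> simp [e, hl]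
  have hfst : ∀ k, (e k).1 = (ℓ k).1 := by
    intro k
    rcases hl : (ℓ k).2 <;> simp [e, hl]
  -- By minimality, a second use of the first edge could only be an immediate return, which
  -- reducedness forbids. The rest of the segment then joins the ends of that edge.
  have hne : ∀ k, i < k → k < i + d → e k ≠ e i := by
    intro k hik hkd hek
    have hki : z i ≠ z k := hmin i k hik (by omega) (by omega)
    have hki' : z (i + 1) = z k → k = i + 1 := by
      intro hz
      by_contra hne
      exact hmin (i + 1) k (by omega) (by omega) (by omega) hz
    have hk1 : z k = z (i + 1) ∧ z (k + 1) = z i := by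
      have h1 := he' k
      rw [hek] at h1
      rcases h1 with ⟨h1, h1'⟩ | ⟨h1, h1'⟩ <;> rcases he' i with ⟨h2, h2'⟩ | ⟨h2, h2'⟩
      · exact absurd (h2.symm.trans h1) hki
      · exact ⟨h1.symm.trans h2, h1'.symm.trans h2'⟩
      · exact ⟨h1'.symm.trans h2', h1.symm.trans h2⟩
      · exact absurd (h2'.symm.trans h1') hki
    obtain rfl := hki' hk1.1.symm
    refine hc.reduced i (by omega) ⟨Prod.ext ?_ ?_, hk1.2⟩
    · rw [← hfst, hek, hfst]
    · have h2 : (e (i + 1)).2.1 = (e i).2.1 := by rw [hek]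
      have h3 : z (i + 1 + 1) ≠ z (i + 1) := fun h => hki (hk1.2.symm.trans h)
      rcases hl : (ℓ i).2 <;> rcases hl' : (ℓ (i + 1)).2
      · simp only [e, hl, hl'] at h2
        exact absurd h2 h3
      · rfl
      · rfl
      · simp only [e, hl, hl'] at h2
        exact absurd h2.symm hki
  let Z : ℕ → D.NonRoot := fun k => if hk : k ≤ h then ⟨z k, hroot k hk⟩ else
    ⟨z 0, hroot 0 (Nat.zero_le _)⟩
  have hZ : ∀ k ≤ h, (Z k).1 = z k := fun k hk => by simp [Z, hk]
  have hi1 : z (i + 1) ≠ D.root := hroot _ (by omega)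
  have hi0 : z i ≠ D.root := hroot _ (by omega)
  have hnr : (e i).2.1 ≠ D.root ∧ (e i).2.2 ≠ D.root := by
    rcases he' i with ⟨h1, h2⟩ | ⟨h1, h2⟩ <;> rw [h1, h2] <;> exact ⟨by assumption, by assumption⟩
  refine ⟨(e i).1, ⟨_, hnr.1⟩, ⟨_, hnr.2⟩, he i (by omega), fun {β} g hg => ?_⟩
  have hstep : ∀ k, i < k → k < i + d → g (Z k) = g (Z (k + 1)) := by
    intro k h1 h2
    have hz0 := hZ k (by omega)
    have hz1 := hZ (k + 1) (by omega)
    have hek := hne k h1 h2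
    have hR := he k (by omega)
    rcases he' k with ⟨h3, h4⟩ | ⟨h3, h4⟩
    · refine hg (e k).1 _ _ (by rw [hz0, hz1, ← h3, ← h4]; exact hR) fun hh => hek ?_
      refine Prod.ext hh.1 (Prod.ext ?_ ?_)
      · rw [h3, ← hz0, hh.2.1]
      · rw [h4, ← hz1, hh.2.2]
    · refine (hg (e k).1 _ _ (by rw [hz0, hz1, ← h3, ← h4]; exact hR) fun hh => hek ?_).symm
      refine Prod.ext hh.1 (Prod.ext ?_ ?_)
      · rw [h3, ← hz1, hh.2.1]
      · rw [h4, ← hz0, hh.2.2]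
  have hwalk : ∀ k, i + 1 ≤ k → k ≤ i + d → g (Z (i + 1)) = g (Z k) := by
    intro k hk
    induction k, hk using Nat.le_induction with
    | base => exact fun _ => rfl
    | succ k hk ih => exact fun h => (ih (by omega)).trans (hstep k (by omega) (by omega))
  have hfin : g (Z (i + 1)) = g (Z i) := by
    rw [hwalk (i + d) (by omega) le_rfl]
    congr 1
    exact Subtype.ext (by rw [hZ _ hih, hZ _ (by omega), hi])
  rcases he' i with ⟨h1, h2⟩ | ⟨h1, h2⟩
  · convert hfin.symm using 2 <;> refine Subtype.ext ?_
    · rw [hZ _ (by omega)]; exact h1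
    · rw [hZ _ (by omega)]; exact h2
  · convert hfin using 2 <;> refine Subtype.ext ?_
    · rw [hZ _ (by omega)]; exact h1
    · rw [hZ _ (by omega)]; exact h2

/-! ### The twisted frames -/

namespace Envelope

variable (M : D.Envelope) {V : Type} (G : SimpleGraph V) (c : Λ) (y z : D.NonRoot)

/-- The relation on `M.P × V`: the edges of `M` keep the second coordinate, except that the edge
from `y` to `z` moves it along an edge of `G`. -/
def TwistRel (a : Λ) (s : M.P) (v : V) (t : M.P) (v' : V) : Prop :=
  M.R a (some s) (some t) ∧
    ((a = c ∧ s = M.ι y ∧ t = M.ι z) ∧ G.Adj v v' ∨ ¬ (a = c ∧ s = M.ι y ∧ t = M.ι z) ∧ v = v')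

/-- The product of `M` with `V` in which the root is not multiplied and the edge `c` from `y` to
`z` is replaced by the edges of `G`. -/
def twist : KripkeFrame Λ where
  W := PUnit.{u + 1} ⊕ M.P × V
  R a
    | .inl _, .inl _ => M.R a none none
    | .inl _, .inr q => M.R a none (some q.1)
    | .inr p, .inl _ => M.R a (some p.1) none
    | .inr p, .inr q => M.TwistRel G c y z a p.1 p.2 q.1 q.2

/-- The projection to `M`. -/
def proj : (M.twist G c y z).W → Option M.P
  | .inl _ => none
  | .inr p => some p.1

variable {M G c y z}

theorem proj_rel {a : Λ} {u u' : (M.twist G c y z).W} (h : (M.twist G c y z).R a u u') :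
    M.R a (M.proj G c y z u) (M.proj G c y z u') := by
  rcases u with u | u <;> rcases u' with u' | u'
  · exact h
  · exact h
  · exact h
  · exact h.1

/-- All points besides the root satisfy `e`. -/
theorem exists_homAt_twist (hyz : D.R c y.1 z.1) (p : M.P × V) :
    ∃ f, D.HomAt (M.twist G c y z).R (.inr p) f := by
  obtain ⟨f, hf0, hf⟩ := M.exists_homAt p.1
  -- The homomorphism in the envelope avoids the edges of `D`, in particular the twisted one, so the
  -- graph coordinate can stay constant.
  refine ⟨fun x => .inr (f x, p.2), congrArg (fun s => Sum.inr (s, p.2)) hf0,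
    fun a x x' hx => ⟨(hf a x x' hx).1, Or.inr ⟨fun h => ?_, rfl⟩⟩⟩
  refine (hf a x x' hx).2 y.1 z.1 (h.1 ▸ hyz) ⟨?_, ?_⟩
  · rw [bottom_nonRoot]; exact congrArg some h.2.1
  · rw [bottom_nonRoot]; exact congrArg some h.2.2

/-- The approximations hold at the root if some edge of `G` is monochromatic. -/
theorem sat_approx_twist (hyz : D.R c y.1 z.1) {n : ℕ} {θ : ℕ → Set (M.twist G c y z).W}
    (h : ∃ v v', G.Adj v v' ∧ ∀ x : D.NonRoot, (M.twist G c y z).colour θ n (.inr (M.ι x, v)) =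
      (M.twist G c y z).colour θ n (.inr (M.ι x, v'))) (w : (M.twist G c y z).W) :
    (M.twist G c y z).Sat θ w (D.approx n) := by
  classical
  rcases w with w | p
  swap
  · obtain ⟨f, hf⟩ := exists_homAt_twist hyz p
    exact hf.sat_approx n
  obtain ⟨v, v', hadj, hcol⟩ := h
  let pt : D.W → V → (M.twist G c y z).W := fun x t =>
    if hx : x = D.root then .inl w else .inr (M.ι ⟨x, hx⟩, t)
  have hpt0 : ∀ t, pt D.root t = .inl w := fun t => dif_pos rfl
  have hpt1 : ∀ (x : D.NonRoot) t, pt x.1 t = .inr (M.ι x, t) := fun x t => dif_neg x.2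
  have hcol' : ∀ x, (M.twist G c y z).colour θ n (pt x v) =
      (M.twist G c y z).colour θ n (pt x v') := by
    intro x
    by_cases hx : x = D.root
    · rw [hx, hpt0, hpt0]
    · rw [hpt1 ⟨x, hx⟩, hpt1 ⟨x, hx⟩, hcol]
  have hedge : ∀ t t', G.Adj t t' → ∀ a x x', D.R a x x' →
      (M.twist G c y z).R a (pt x t) (pt x' t) ∨ (M.twist G c y z).R a (pt x t) (pt x' t') := by
    intro t t' ht a x x' hx
    have hM := M.homAt.2 a x x' hx
    by_cases h0 : x = D.root <;> by_cases h1 : x' = D.root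
    · subst h0; subst h1
      rw [hpt0, hpt0]
      rw [bottom_root] at hM
      exact Or.inl hM
    · subst h0
      rw [hpt0, hpt1 ⟨x', h1⟩]
      rw [bottom_root, bottom_nonRoot M.ι ⟨x', h1⟩] at hM
      exact Or.inl hM
    · subst h1
      rw [hpt0, hpt1 ⟨x, h0⟩]
      rw [bottom_root, bottom_nonRoot M.ι ⟨x, h0⟩] at hM
      exact Or.inl hM
    · rw [hpt1 ⟨x, h0⟩, hpt1 ⟨x', h1⟩, hpt1 ⟨x', h1⟩]
      rw [bottom_nonRoot M.ι ⟨x, h0⟩, bottom_nonRoot M.ι ⟨x', h1⟩] at hM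
      by_cases hs : a = c ∧ M.ι ⟨x, h0⟩ = M.ι y ∧ M.ι ⟨x', h1⟩ = M.ι z
      · exact Or.inr ⟨hM, Or.inl ⟨hs, ht⟩⟩
      · exact Or.inl ⟨hM, Or.inr ⟨hs, rfl⟩⟩
  -- Each point is simulated by its copies over both `v` and `v'`; the twisted edge swaps the
  -- copies, unnoticed by the colours.
  refine sat_approx_of_simulation (fun x => (M.twist G c y z).colour θ n (pt x v))
    (fun x u => u = pt x v ∨ u = pt x v') (Or.inl (hpt0 v).symm) ?_
  rintro x u (rfl | rfl)
  · refine ⟨rfl, fun a x' hx => ?_⟩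
    rcases hedge v v' hadj a x x' hx with h | h
    · exact ⟨_, h, Or.inl rfl⟩
    · exact ⟨_, h, Or.inr rfl⟩
  · refine ⟨(hcol' x).symm, fun a x' hx => ?_⟩
    rcases hedge v' v hadj.symm a x x' hx with h | h
    · exact ⟨_, h, Or.inr rfl⟩
    · exact ⟨_, h, Or.inl rfl⟩

/-- A homomorphism from the diagram to `M` that fixes the root is an automorphism of `D` followed
by the embedding. -/
theorem exists_section (hD : D.IsRooted) {α : D.W → Option M.P} (hα : D.HomAt M.R none α) :
    ∃ σ : D.W → D.W, σ D.root = D.root ∧ (∀ x, α (σ x) = bottom M.ι x) ∧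
      ∀ a x x', D.R a x x' → D.R a (σ x) (σ x') := by
  classical
  have hinj : Function.Injective (bottom M.ι : D.W → Option M.P) := by
    intro x x' h
    by_cases h0 : x = D.root <;> by_cases h1 : x' = D.root
    · rw [h0, h1]
    · simp [bottom, h0, h1] at h
    · simp [bottom, h0, h1] at h
    · simp only [bottom, h0, h1, dite_false, Option.some.injEq] at h
      exact congrArg Subtype.val (M.injective h)
  have hex : ∀ e : D.edges, ∃ e' : D.edges, e'.1.1 = e.1.1 ∧
      α e'.1.2.1 = bottom M.ι e.1.2.1 ∧ α e'.1.2.2 = bottom M.ι e.1.2.2 := by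
    rintro ⟨⟨a, x, x'⟩, he⟩
    obtain ⟨s, t, h1, h2, h3⟩ := M.uses_edge a x x' he α hα
    exact ⟨⟨(a, s, t), h1⟩, rfl, h2, h3⟩
  choose E hE1 hE2 hE3 using hex
  have hEinj : Function.Injective E := by
    rintro e e' h
    refine Subtype.ext (Prod.ext ?_ (Prod.ext ?_ ?_))
    · rw [← hE1 e, ← hE1 e', h]
    · exact hinj (by rw [← hE2 e, ← hE2 e', h])
    · exact hinj (by rw [← hE3 e, ← hE3 e', h])
  -- Choosing for each edge a preimage edge is injective on a finite set, hence surjective. So `α`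
  -- maps all of `D` into the bottom copy, and bijectively on points.
  have hEsurj := Finite.surjective_of_injective hEinj
  have hin : ∀ x, x = D.root ∨ ∃ e : D.edges, e.1.2.2 = x := by
    intro x
    rcases Relation.ReflTransGen.cases_tail (hD x) with h | ⟨s, -, a, ha⟩
    · exact Or.inl h
    · exact Or.inr ⟨⟨(a, s, x), ha⟩, rfl⟩
  have hα' : ∀ x, ∃ x', α x = bottom M.ι x' := by
    intro x
    rcases hin x with rfl | ⟨e, rfl⟩
    · exact ⟨D.root, by rw [hα.1, bottom_root]⟩
    · obtain ⟨e', rfl⟩ := hEsurj e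
      exact ⟨_, hE3 e'⟩
  choose τ hτ using hα'
  have hτsurj : Function.Surjective τ := by
    intro x
    rcases hin x with rfl | ⟨e, rfl⟩
    · exact ⟨D.root, hinj (by rw [← hτ, hα.1, bottom_root])⟩
    · exact ⟨_, hinj ((hτ _).symm.trans (hE3 e))⟩
  have hτinj := Finite.injective_iff_surjective.2 hτsurj
  choose σ hσ using hτsurj
  have hs : ∀ x, α (σ x) = bottom M.ι x := fun x => by rw [hτ, hσ]
  have hs' : ∀ x s, α s = bottom M.ι x → s = σ x := fun x s h =>
    hτinj (by rw [hσ]; exact hinj (by rw [← hτ, h]))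
  refine ⟨σ, (hs' _ _ (by rw [hα.1, bottom_root])).symm, hs, fun a x x' h => ?_⟩
  obtain ⟨s, t, h1, h2, h3⟩ := M.uses_edge a x x' h α hα
  rwa [← hs' x s h2, ← hs' x' t h3]

/-- A proper colouring of `G` refutes an approximation at the root. -/
theorem exists_not_valid (hD : D.IsRooted) (M : D.Envelope) (hyz : D.R c y.1 z.1)
    (hcyc : ∀ {β : Type u} (g : D.NonRoot → β), (∀ a (x x' : D.NonRoot), D.R a x.1 x'.1 →
      ¬ (a = c ∧ x = y ∧ x' = z) → g x = g x') → g y = g z) (l : ℕ) :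
    ∃ n, ∀ {V : Type} {G : SimpleGraph V}, G.Colorable l →
      ¬ (M.twist G c y z).Valid (D.approx n) := by
  classical
  have := M.finite
  obtain ⟨B, hB⟩ := hD.exists_map_of_sat_approx
  obtain ⟨N, ⟨code⟩⟩ := Finite.exists_equiv_fin (Option (M.P × Fin l))
  refine ⟨max B N, fun {V G} ⟨κ⟩ hval => ?_⟩
  let col : (M.twist G c y z).W → Option (M.P × Fin l)
    | .inl _ => none
    | .inr p => some (p.1, κ p.2)
  have hproj : ∀ u, M.proj G c y z u = (col u).map Prod.fst := by
    rintro (u | u) <;> rfl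
  -- Each variable marks one class of points, so colours recover both the point of the envelope and
  -- the colour of the vertex.
  let θ : ℕ → Set (M.twist G c y z).W := fun p => {u | (code (col u) : ℕ) = p}
  obtain ⟨u, hu0, hu⟩ := hB (max B N) (le_max_left _ _) _ θ (.inl PUnit.unit) (hval θ _)
  have hcol : ∀ s t, (M.twist G c y z).colour θ (max B N) s =
      (M.twist G c y z).colour θ (max B N) t → col s = col t := by
    intro s t h
    have h1 := congrFun h ⟨code (col t), (code (col t)).2.trans_le (le_max_right _ _)⟩
    have h2 : (code (col s) : ℕ) = code (col t) := h1.mpr rfl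
    exact code.injective (Fin.ext h2)
  have hα : D.HomAt M.R none fun x => M.proj G c y z (u x) := by
    refine ⟨congrArg (M.proj G c y z) hu0, fun a x x' hx => ?_⟩
    obtain ⟨u', hR, hc⟩ := hu a x x' hx
    have := proj_rel hR
    rwa [hproj u', hcol _ _ hc, ← hproj] at this
  obtain ⟨σ, -, hσ, hσR⟩ := exists_section hD hα
  have hcase : ∀ x : D.NonRoot, ∃ v, u (σ x.1) = .inr (M.ι x, v) := by
    intro x
    have h := hσ x.1
    rw [bottom_nonRoot] at h
    rcases hux : u (σ x.1) with s | s
    · rw [hux] at h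
      simp [proj] at h
    · rw [hux] at h
      simp only [proj, Option.some.injEq] at h
      exact ⟨s.2, by rw [← h]⟩
  choose v hv using hcase
  have key : ∀ a (x x' : D.NonRoot), D.R a x.1 x'.1 → ∃ t, κ t = κ (v x') ∧
      M.TwistRel G c y z a (M.ι x) (v x) (M.ι x') t := by
    intro a x x' hx
    obtain ⟨u', hR, hc⟩ := hu a _ _ (hσR a _ _ hx)
    have h := hcol _ _ hc
    rw [hv] at h hR
    rcases u' with s | s
    · simp [col] at h
    · simp only [col, Option.some.injEq, Prod.mk.injEq] at h
      exact ⟨s.2, h.2, h.1 ▸ hR⟩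
  -- Untwisted edges keep the vertex colour, so the rest of the cycle gives equal colours at `y` and
  -- `z`; properness of `κ` on the twisted edge excludes this.
  have hg := hcyc (fun x => ULift.up.{u} (κ (v x))) fun a x x' hx hne => by
    obtain ⟨t, ht, -, ⟨h, -⟩ | ⟨-, h⟩⟩ := key a x x' hx
    · exact absurd ⟨h.1, M.injective h.2.1, M.injective h.2.2⟩ hne
    · rw [← ht, h]
  obtain ⟨t, ht, -, ⟨-, h⟩ | ⟨h, -⟩⟩ := key c y z hyz
  · exact κ.valid h (by rw [ht]; exact congrArg ULift.down hg)
  · exact h ⟨rfl, rfl, rfl⟩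

end Envelope

end FinPointedFrame

end ModalDiagram

namespace ModalDiagram

open ModalFormula

variable {Λ : Type u}

namespace FinPointedFrame

variable {D : FinPointedFrame Λ}

namespace Envelope

/-! ### The topology of the twisted frames -/

variable {M : D.Envelope} {V : Type} {G : SimpleGraph V} {c : Λ} {y z : D.NonRoot}

section Topology

variable [TopologicalSpace V]

instance : TopologicalSpace (M.twist G c y z).W :=
  letI : TopologicalSpace M.P := ⊥
  inferInstanceAs (TopologicalSpace (PUnit.{u + 1} ⊕ M.P × V))

theorem isOpen_twist_iff {U : Set (M.twist G c y z).W} :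
    IsOpen U ↔ ∀ s : M.P, IsOpen {v : V | Sum.inr (s, v) ∈ U} := by
  let _ : TopologicalSpace M.P := ⊥
  have : DiscreteTopology M.P := ⟨rfl⟩
  refine (isOpen_sum_iff (X := PUnit.{u + 1}) (Y := M.P × V)).trans ⟨fun h s => ?_, fun h => ?_⟩
  · exact h.2.preimage (Continuous.prodMk_right s)
  · refine ⟨isOpen_discrete _, ?_⟩
    have : (Sum.inr ⁻¹' U : Set (M.P × V)) = ⋃ s : M.P, {s} ×ˢ {v : V | Sum.inr (s, v) ∈ U} := by
      ext ⟨s, v⟩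
      simp only [Set.mem_iUnion, Set.mem_prod, Set.mem_singleton_iff, exists_eq_left',
        Set.mem_ofPred_eq]
      rfl
    rw [this]
    exact isOpen_iUnion fun s => (isOpen_discrete _).prod (h s)

theorem isClosed_twist_iff {U : Set (M.twist G c y z).W} :
    IsClosed U ↔ ∀ s : M.P, IsClosed {v : V | Sum.inr (s, v) ∈ U} := by
  rw [← isOpen_compl_iff, isOpen_twist_iff]
  exact forall_congr' fun s => isOpen_compl_iff (s := {v : V | Sum.inr (s, v) ∈ U})

theorem isClopen_twist_iff {U : Set (M.twist G c y z).W} :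
    IsClopen U ↔ ∀ s : M.P, IsClopen {v : V | Sum.inr (s, v) ∈ U} := by
  rw [IsClopen, isClosed_twist_iff, isOpen_twist_iff, ← forall_and]
  rfl

instance [CompactSpace V] : CompactSpace (M.twist G c y z).W :=
  letI : TopologicalSpace M.P := ⊥
  haveI := M.finite
  inferInstanceAs (CompactSpace (PUnit.{u + 1} ⊕ M.P × V))

instance [T2Space V] : T2Space (M.twist G c y z).W :=
  letI : TopologicalSpace M.P := ⊥
  haveI : DiscreteTopology M.P := ⟨rfl⟩
  inferInstanceAs (T2Space (PUnit.{u + 1} ⊕ M.P × V))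

instance [TotallyDisconnectedSpace V] : TotallyDisconnectedSpace (M.twist G c y z).W :=
  letI : TopologicalSpace M.P := ⊥
  haveI : DiscreteTopology M.P := ⟨rfl⟩
  inferInstanceAs (TotallyDisconnectedSpace (PUnit.{u + 1} ⊕ M.P × V))

instance [SecondCountableTopology V] : SecondCountableTopology (M.twist G c y z).W :=
  letI : TopologicalSpace M.P := ⊥
  haveI : DiscreteTopology M.P := ⟨rfl⟩
  haveI := M.finite
  inferInstanceAs (SecondCountableTopology (PUnit.{u + 1} ⊕ M.P × V))

theorem isClosed_twist_successors [T2Space V] (hG : ∀ v, IsClosed {v' | G.Adj v v'}) (a : Λ)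
    (u : (M.twist G c y z).W) : IsClosed {u' | (M.twist G c y z).R a u u'} := by
  rw [isClosed_twist_iff]
  intro t
  rcases u with u | ⟨s, v⟩
  · exact isClosed_const (p := M.R a none (some t))
  · change IsClosed {v' | M.TwistRel G c y z a s v t v'}
    by_cases hR : M.R a (some s) (some t)
    · by_cases hs : a = c ∧ s = M.ι y ∧ t = M.ι z
      · obtain ⟨rfl, rfl, rfl⟩ := hs
        simpa [TwistRel, hR] using hG v
      · simp only [TwistRel, hR, hs, true_and, false_and, false_or, not_false_eq_true]
        exact isClosed_eq continuous_const continuous_id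
    · simp [TwistRel, hR]

/-- A preimage splits into finitely many pieces over `M.P`; only the twisted edge needs the
hypothesis on `G`. -/
theorem isModalAlgebra_twist (hG : ∀ U, IsClopen U → IsClopen {v | ∃ v', G.Adj v v' ∧ v' ∈ U}) :
    IsModalAlgebra (M.twist G c y z) {U | IsClopen U} where
  bot := isClopen_empty
  imp U hU V hV := by
    have : {x | x ∈ U → x ∈ V} = Uᶜ ∪ V := by
      ext
      simp [imp_iff_not_or]
    exact this ▸ hU.compl.union hV
  dia a U hU := by
    have := M.finite
    have hU' := isClopen_twist_iff.1 hU
    refine isClopen_twist_iff.2 fun s => ?_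
    have h : {v : V | Sum.inr (s, v) ∈ {u | ∃ u', (M.twist G c y z).R a u u' ∧ u' ∈ U}} =
        {_v : V | M.R a (some s) none ∧ ∃ p, Sum.inl p ∈ U} ∪
          ⋃ t : M.P, {v | ∃ v', M.TwistRel G c y z a s v t v' ∧ Sum.inr (t, v') ∈ U} := by
      ext v
      simp only [Set.mem_ofPred_eq, Set.mem_union, Set.mem_iUnion]
      constructor
      · rintro ⟨u' | u', h1, h2⟩
        · exact Or.inl ⟨h1, _, h2⟩
        · exact Or.inr ⟨u'.1, u'.2, h1, h2⟩
      · rintro (⟨h1, p, h2⟩ | ⟨t, v', h1, h2⟩)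
        · exact ⟨.inl p, h1, h2⟩
        · exact ⟨.inr (t, v'), h1, h2⟩
    rw [h]
    refine IsClopen.union ⟨isClosed_const, isOpen_const⟩ (isClopen_iUnion_of_finite fun t => ?_)
    by_cases hR : M.R a (some s) (some t)
    · by_cases hs : a = c ∧ s = M.ι y ∧ t = M.ι z
      · obtain ⟨rfl, rfl, rfl⟩ := hs
        simpa [TwistRel, hR] using hG _ (hU' (M.ι z))
      · simpa [TwistRel, hR, hs] using hU' t
    · simp [TwistRel, hR, isClopen_empty]

end Topology

/-- The approximations hold in the twisted frame under all valuations in a family if no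
colouring with sufficiently few colours that arises from the family is proper. -/
theorem approx_mem_generalLog (hyz : D.R c y.1 z.1) {A : Set (Set (M.twist G c y z).W)} {n : ℕ}
    (h : ∀ θ : ℕ → Set (M.twist G c y z).W, (∀ p, θ p ∈ A) → ∃ v v', G.Adj v v' ∧
      (fun x : D.NonRoot => (M.twist G c y z).colour θ n (.inr (M.ι x, v))) =
        fun x : D.NonRoot => (M.twist G c y z).colour θ n (.inr (M.ι x, v'))) :
    D.approx n ∈ generalLog (M.twist G c y z) A := fun θ hθ w => by
  obtain ⟨v, v', h1, h2⟩ := h θ hθ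
  exact sat_approx_twist hyz ⟨v, v', h1, fun x => congrFun h2 x⟩ w

end Envelope

/-! ### Infinitely many non-canonical axioms -/

/-- The number of colours that matter for the first `n` approximations. -/
theorem exists_colours_bound (n : ℕ) : ∃ K, ∀ i ≤ n, Nat.card (D.NonRoot → Fin i → Prop) ≤ K := by
  obtain ⟨K, hK⟩ := ((Set.finite_Iic n).image
    fun i => Nat.card (D.NonRoot → Fin i → Prop)).bddAbove
  exact ⟨K, fun i hi => hK ⟨i, hi, rfl⟩⟩

theorem IsRooted.infinite_of_axiomatises (hD : D.IsRooted) (hmin : D.GloballyMinimal)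
    (hcyc : D.HasInnerCycle) {Γ : Set (ModalFormula Λ)} (hΓ : Axiomatises Γ (Log D.frameClass)) :
    {φ | φ ∈ Γ ∧ ¬ IsCanonicalFormula φ}.Infinite := by
  intro hfin
  have hL : Log D.frameClass = KPlus Γ := hΓ.unique (axiomatises_KPlus Γ)
  have hΓL : Γ ⊆ Log D.frameClass := hΓ.1.2
  obtain ⟨c, y, z, hyz, hc⟩ := hcyc.exists_edge
  obtain ⟨M⟩ := hmin.nonempty_envelope hD
  obtain ⟨k, hk⟩ := hD.exists_subset_KPlus hfin fun φ hφ => hΓL hφ.1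
  -- The order of choices matters: `K` comes from the non-canonical axioms, `n` from `K`, and `N`
  -- from a derivation of `approx n`; the graph depends on `K` and `N` only.
  obtain ⟨K, hK⟩ := exists_colours_bound (D := D) k
  obtain ⟨n, hn⟩ := Envelope.exists_not_valid hD M hyz hc (K + 2)
  obtain ⟨Γ₀, hΓ₀, hfin₀, hnΓ₀⟩ := exists_finite_of_mem_KPlus (hL ▸ D.approx_mem_Log n)
  obtain ⟨m, hm⟩ := hD.exists_subset_KPlus hfin₀ (hΓ₀.trans hΓL)
  obtain ⟨N, hN⟩ := exists_colours_bound (D := D) m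
  obtain ⟨V, _, G, _, _, _, _, hG1, hG2, hG3, hG4, hG5⟩ := exists_graph.{u} K N
  let F := M.twist G c y z
  have hA : IsModalAlgebra F {U | IsClopen U} := Envelope.isModalAlgebra_twist hG2
  have hclopen : KPlus (D.approx '' Set.Iic m) ⊆ generalLog F {U | IsClopen U} := by
    refine KPlus_subset hA.isNormalLogic ?_
    rintro _ ⟨i, hi, rfl⟩
    refine Envelope.approx_mem_generalLog hyz fun θ hθ => ?_
    -- A vertex is coloured by the tuple of colours of its copies over `D`; the fibres are open
    -- because the valuation is clopen.
    refine hG5 (D.NonRoot → Fin i → Prop) _ (hN i hi) fun s => ?_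
    have : ((fun (v : V) (x : D.NonRoot) => F.colour θ i (.inr (M.ι x, v))) ⁻¹' {s}) =
        ⋂ x, ⋂ p : Fin i, {v | Sum.inr (M.ι x, v) ∈ θ p ↔ s x p} := by
      ext v
      simp only [Set.mem_preimage, Set.mem_singleton_iff, Set.mem_iInter, Set.mem_ofPred_eq,
        funext_iff, KripkeFrame.colour, eq_iff_iff]
      rfl
    rw [this]
    refine isOpen_iInter_of_finite fun x => isOpen_iInter_of_finite fun p => ?_
    have hx := Envelope.isClopen_twist_iff.1 (hθ p) (M.ι x)
    by_cases hs : s x p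
    · simpa [hs] using hx.isOpen
    · simp only [hs, iff_false]
      exact hx.compl.isOpen
  have hfull : KPlus (D.approx '' Set.Iic k) ⊆ generalLog F Set.univ := by
    refine KPlus_subset (IsModalAlgebra.univ F).isNormalLogic ?_
    rintro _ ⟨i, hi, rfl⟩
    exact Envelope.approx_mem_generalLog hyz fun θ _ =>
      hG4 (D.NonRoot → Fin i → Prop) _ (hK i hi)
  have hvalid : Γ₀ ⊆ generalLog F Set.univ := by
    intro φ hφ
    -- Canonical axioms pass from the clopen frame to the Kripke frame; the others follow from
    -- approximations with at most `K` colours.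
    by_cases hcan : IsCanonicalFormula φ
    · exact mem_generalLog_univ.2 (hcan.valid_of_clopen
        (Envelope.isClosed_twist_successors hG1) hA (hclopen (hm hφ)))
    · exact hfull (hk ⟨hΓ₀ hφ, hcan⟩)
  exact hn hG3 (mem_generalLog_univ.1
    (KPlus_subset (IsModalAlgebra.univ F).isNormalLogic hvalid hnΓ₀))

end FinPointedFrame

end ModalDiagram

theorem mainTheorem3 {Λ : Type u} (D : ModalDiagram.Diagram Λ)
    (hmin : D.GloballyMinimal) (hcyc : D.HasInnerCycle) :
    ModalDiagram.IsCanonicalLogic (ModalDiagram.Log D.frameClass) ∧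
      ∀ Γ : Set (ModalDiagram.ModalFormula Λ),
        ModalDiagram.Axiomatises Γ (ModalDiagram.Log D.frameClass) →
          {φ | φ ∈ Γ ∧ ¬ ModalDiagram.IsCanonicalFormula φ}.Infinite :=
  ⟨D.rooted.isCanonicalLogic, fun _ hΓ => D.rooted.infinite_of_axiomatises hmin hcyc hΓ⟩
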